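/- Let $n\ge 0$ and $p\ge 0$ be integers. For each $a=1,\dots,p$ let $N_a\ge 1$ be an integer and let $k_{a1}\ge k_{a2}\ge\cdots\ge k_{aN_a}\ge 1$ be integers with sum $n_a$, where $n_1+\cdots+n_p=n$. Put $k_{aj}=0$ for $j>N_a$, and $N^\ast=\max_a N_a$ ($N^\ast=0$ if $p=0$). Let $\mathcal S\subset\mathbb C^{n\times n}$ be the set of all complex $n\times n$ matrices $A$ that have exactly $p$ distinct eigenvalues, of arbitrary values, which can be labelled $\lambda_1,\dots,\lambda_p$ in such a way that, for every $a$, the Jordan blocks with eigenvalue $\lambda_a$ in the Jordan canonical form of $A$ are $N_a$ in number and have the orders $k_{a1},\dots,k_{aN_a}$ (so $\lambda_a$ has algebraic multiplicity $n_a$). Then $\mathcal S$ is a nonempty embedded complex submanifold of $\mathbb C^{n\times n}$ of complex dimension $$\dim_{\mathbb C}\mathcal S \;=\; n^2-\sum_{j=1}^{N^\ast}(2j-1)\sum_{a=1}^{p}k_{aj}+p .$$ Moreover, for every $A\in\mathcal S$, $$\dim_{\mathbb C}\mathcal S \;=\; n^2-\sum_{j=1}^{N^\ast}(2j-1)\,m_j+p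 ,$$ where $m_j$ is the degree of the $j$-th invariant polynomial $D_{n-j+1}/D_{n-j}$ of $A$; here $D_r$ is the monic greatest common divisor of all $r\times r$ minors of $xI-A$, and $D_0=1$. -/

import Mathlib

open scoped Polynomial

noncomputable section

/-- The set `S` in a finite-dimensional complex vector space `E` has complex dimension `d`:
it is nonempty, and it is an embedded complex submanifold all of whose components have complex
dimension `d`, that is, around each of its points there is a biholomorphic map between open
subsets of `E` that straightens `S` to a complex linear subspace of dimension `d`. -/
def HasComplexDim {E : Type*} [AddCommGroup E] [Module ℂ E] [TopologicalSpace E]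
    (S : Set E) (d : ℕ) : Prop :=
  S.Nonempty ∧ ∀ x ∈ S, ∃ (φ : OpenPartialHomeomorph E E) (V : Submodule ℂ E),
    x ∈ φ.source ∧
    DifferentiableOn ℂ φ φ.source ∧
    DifferentiableOn ℂ φ.symm φ.target ∧
    Module.finrank ℂ V = d ∧
    ∀ y ∈ φ.source, y ∈ S ↔ φ y ∈ V

/-- The Jordan block of order `k` with eigenvalue `z`: `z` on the diagonal and `1` just above
it. -/
def jordanBlock (k : ℕ) (z : ℂ) : Matrix (Fin k) (Fin k) ℂ :=
  Matrix.of fun s t => if s = t then z else if (s : ℕ) + 1 = (t : ℕ) then 1 else 0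

/-- The row (and column) indices of a Jordan matrix with `p` eigenvalues, the `a`-th one occurring
in `N a` blocks of orders `k a 1, …, k a (N a)`: a pair (eigenvalue, block) and a position in that
block. The block number `j : Fin (N a)` counts from zero, hence the order `k a (j + 1)`. -/
abbrev JordanIndex {p : ℕ} (N : Fin p → ℕ) (k : Fin p → ℕ → ℕ) : Type :=
  Σ b : (Σ a : Fin p, Fin (N a)), Fin (k b.1 ((b.2 : ℕ) + 1))

/-- The block diagonal matrix of the Jordan blocks of orders `k a 1, …, k a (N a)` with
eigenvalue `ev a`, for all `a`. -/
def jordanMatrix {p : ℕ} (N : Fin p → ℕ) (k : Fin p → ℕ → ℕ) (ev : Fin p → ℂ) :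
    Matrix (JordanIndex N k) (JordanIndex N k) ℂ :=
  Matrix.blockDiagonal' fun b : (Σ a : Fin p, Fin (N a)) =>
    jordanBlock (k b.1 ((b.2 : ℕ) + 1)) (ev b.1)

/-- The set of complex `n × n` matrices `A` that have exactly `p` distinct eigenvalues, of any
values `ev a`, and whose Jordan canonical form consists of `N a` blocks of orders
`k a 1, …, k a (N a)` for each eigenvalue `ev a`. The bijection `e` only numbers the rows of the
Jordan matrix. -/
def jordanSet (n : ℕ) {p : ℕ} (N : Fin p → ℕ) (k : Fin p → ℕ → ℕ) :
    Set (Matrix (Fin n) (Fin n) ℂ) :=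
  {A | ∃ (ev : Fin p → ℂ) (e : Fin n ≃ JordanIndex N k) (T : GL (Fin n) ℂ),
    Function.Injective ev ∧
    A = (T : Matrix (Fin n) (Fin n) ℂ) * (jordanMatrix N k ev).submatrix e e *
      ((T⁻¹ : GL (Fin n) ℂ) : Matrix (Fin n) (Fin n) ℂ)}

/-- The `r`-th determinantal divisor of `A`: the monic greatest common divisor (normalized
generator of the ideal) of all minors of order `r` of the characteristic matrix `X • 1 - A`. -/
def determinantalDivisor {n : ℕ} (A : Matrix (Fin n) (Fin n) ℂ) (r : ℕ) : ℂ[X] :=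
  normalize (Submodule.IsPrincipal.generator (Ideal.span
    {q : ℂ[X] | ∃ f g : Fin r ↪ Fin n, q = (A.charmatrix.submatrix f g).det}))

/-- The `j`-th invariant polynomial of `A`, for `1 ≤ j ≤ n`: the quotient of the determinantal
divisors of orders `n - j + 1` and `n - j`. Thus the first one is the minimal polynomial. -/
def invariantPolynomial {n : ℕ} (A : Matrix (Fin n) (Fin n) ℂ) (j : ℕ) : ℂ[X] :=
  determinantalDivisor A (n + 1 - j) / determinantalDivisor A (n - j)

end

/-! Fix `A` in the set. Moving its eigenvalues while keeping a Jordan basis gives an affine space `A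
+ P` with `dim P = p` (`eigenShift`). The directions in `P` meet the commutators with `A` only in 0,
by a trace pairing. So the union of the conjugacy classes through `A + P` should be, near `A`, a
manifold with tangent space `range (ad A) ⊕ P`, of dimension `n² - dim (centralizer) + p`.

Two facts turn this into a chart (`exists_straightening`). First, a nearby matrix `B` of the same
Jordan type is similar to a point of `A + P` near `A` (`eventually_exists_shift`). This rests on
semicontinuity of the dimension of `{X | B X = X J}` for a test Jordan block `J`, together with the
fact that a permutation of the eigenvalues cannot lower every term of a fixed sum. Second, the
conjugating matrix can be taken near 1: the intertwiners between `B` and that point form a space of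
the same dimension as the centralizer of `A`, so the kernel vector 1 can be followed.

The centralizer has dimension `∑ min (k a i) (k a j)` over pairs of blocks with a common eigenvalue,
which is `∑ (2j-1) k a j` because the orders decrease. For the formula in terms of invariant
polynomials, the Smith form of a Jordan block reduces the determinantal divisors to products of
diagonal entries, and the `j`-th invariant polynomial has degree `∑ a, k a j`. -/

noncomputable section

/-! ### Kernels of continuous families of linear maps. -/

section KernelPerturbation

open Topology Filter

variable {X E F : Type*} [TopologicalSpace X]
  [NormedAddCommGroup E] [NormedSpace ℂ E]
  [NormedAddCommGroup F] [NormedSpace ℂ F]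

/-- A projection onto a subspace of a vector space that kills a disjoint subspace. -/
theorem exists_linearMap_projection {V : Type*} [AddCommGroup V] [Module ℂ V]
    {R P : Submodule ℂ V} (h : Disjoint R P) :
    ∃ ρ : V →ₗ[ℂ] V, (∀ v, ρ v ∈ R) ∧ (∀ v ∈ R, ρ v = v) ∧ ∀ v ∈ P, ρ v = 0 := by
  obtain ⟨W, hW, hc⟩ := h.symm.exists_isCompl
  refine ⟨R.subtype ∘ₗ R.projectionOnto W hc.symm, fun v => Subtype.mem _, fun v hv => ?_,
    fun v hv => ?_⟩
  · simpa using congrArg Subtype.val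
      (Submodule.projectionOnto_apply_left hc.symm (⟨v, hv⟩ : R))
  · simpa using congrArg Subtype.val
      (Submodule.projectionOnto_apply_right hc.symm (⟨v, hW hv⟩ : W))

/-- A linear map `f` has a generalized inverse `g` such that `g ∘ f = 1 - q`, for every
projection `q` onto the kernel of `f`. -/
theorem exists_generalizedInverse {V W : Type*} [AddCommGroup V] [Module ℂ V]
    [AddCommGroup W] [Module ℂ W] (f : V →ₗ[ℂ] W) (q : V →ₗ[ℂ] V)
    (hq : ∀ v, f v = 0 → q v = v) :
    ∃ g : W →ₗ[ℂ] V, ∀ v, g (f v) = v - q v := by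
  have hker : LinearMap.ker f ≤ LinearMap.ker (LinearMap.id - q) := by
    intro v hv
    simp [hq v hv]
  obtain ⟨s, hs⟩ := LinearMap.exists_leftInverse_of_injective
    ((LinearMap.ker f).liftQ f le_rfl) (Submodule.ker_liftQ_eq_bot _ _ _ le_rfl)
  refine ⟨(LinearMap.ker f).liftQ (LinearMap.id - q) hker ∘ₗ s, fun v => ?_⟩
  have := LinearMap.congr_fun hs (Submodule.Quotient.mk v)
  simp only [LinearMap.comp_apply, Submodule.liftQ_apply, LinearMap.id_apply] at this ⊢
  rw [this]
  simp

/-- With `g ∘ L x₀ = 1 - q`, the map `M x = g ∘ L x + q` is 1 at `x₀` and agrees with `q` on the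
kernel of `L x`. Near `x₀` it is invertible, hence it embeds that kernel into the kernel of `L x₀`
when `q` projects onto the latter. -/
theorem exists_ker_transport [FiniteDimensional ℂ E] [FiniteDimensional ℂ F] (L : X → E →L[ℂ] F) (hL : Continuous L) (x₀ : X)
    (q : E →ₗ[ℂ] E) (hq : ∀ v, L x₀ v = 0 → q v = v) :
    ∃ M : X → E →L[ℂ] E, Continuous M ∧ M x₀ = 1 ∧ ∀ x v, L x v = 0 → M x v = q v := by
  obtain ⟨g, hg⟩ := exists_generalizedInverse (L x₀ : E →ₗ[ℂ] F) q hq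
  refine ⟨fun x => (LinearMap.toContinuousLinearMap g).comp (L x) +
    LinearMap.toContinuousLinearMap q, by fun_prop, ?_, fun x v hv => by simp [hv]⟩
  ext v
  have := hg v
  simp only [ContinuousLinearMap.coe_coe] at this
  simp [this]

theorem eventually_isUnit_of_eq_one {A : Type*} [NormedRing A] [CompleteSpace A]
    {M : X → A} (hM : Continuous M) {x₀ : X} (h : M x₀ = 1) : ∀ᶠ x in 𝓝 x₀, IsUnit (M x) :=
  hM.continuousAt.eventually_mem (Units.isOpen.mem_nhds (by simp [h]))

theorem exists_projection_ker (f : E →L[ℂ] F) :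
    ∃ q : E →ₗ[ℂ] E, (∀ v, f (q v) = 0) ∧ ∀ v, f v = 0 → q v = v := by
  obtain ⟨q, h1, h2, -⟩ := exists_linearMap_projection
    (disjoint_bot_right (a := LinearMap.ker (f : E →ₗ[ℂ] F)))
  exact ⟨q, fun v => by simpa using h1 v, fun v hv => h2 v (by simpa using hv)⟩

theorem isUnit_clm_injective {M : E →L[ℂ] E} (h : IsUnit M) : Function.Injective M := by
  obtain ⟨u, rfl⟩ := h
  intro a b hab
  have := congrArg (fun w => (↑u⁻¹ : E →L[ℂ] E) w) hab
  simpa [← mul_apply_eq_comp] using this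

/-- The dimension of the kernel of a linear map is upper semicontinuous. -/
theorem eventually_finrank_ker_le [FiniteDimensional ℂ E] [FiniteDimensional ℂ F] (L : X → E →L[ℂ] F) (hL : Continuous L) (x₀ : X) :
    ∀ᶠ x in 𝓝 x₀, Module.finrank ℂ (LinearMap.ker (L x : E →ₗ[ℂ] F)) ≤
      Module.finrank ℂ (LinearMap.ker (L x₀ : E →ₗ[ℂ] F)) := by
  obtain ⟨q, hq1, hq2⟩ := exists_projection_ker (L x₀)
  obtain ⟨M, hMc, hM1, hM⟩ := exists_ker_transport L hL x₀ q hq2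
  filter_upwards [eventually_isUnit_of_eq_one hMc hM1] with x hx
  refine LinearMap.finrank_le_finrank_of_injective
    (f := (M x : E →ₗ[ℂ] E).restrict (p := LinearMap.ker (L x : E →ₗ[ℂ] F))
      (q := LinearMap.ker (L x₀ : E →ₗ[ℂ] F)) fun v hv => ?_) ?_
  · have : L x v = 0 := by simpa using hv
    simp [hM x v this, hq1]
  · intro a b hab
    exact Subtype.ext (isUnit_clm_injective hx (congrArg Subtype.val hab))

/-- If the dimension of the kernel does not change, then kernel vectors can be followed. -/
theorem eventually_exists_mem_ker [FiniteDimensional ℂ E] [FiniteDimensional ℂ F] (L : X → E →L[ℂ] F) (hL : Continuous L) (x₀ : X)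
    (q : E →ₗ[ℂ] E) (hq1 : ∀ v, L x₀ (q v) = 0) (hq2 : ∀ v, L x₀ v = 0 → q v = v)
    (v : E) (hv : L x₀ v = 0) (U : Set E) (hU : U ∈ 𝓝 v) :
    ∀ᶠ x in 𝓝 x₀, Module.finrank ℂ (LinearMap.ker (L x : E →ₗ[ℂ] F)) =
      Module.finrank ℂ (LinearMap.ker (L x₀ : E →ₗ[ℂ] F)) → ∃ u ∈ U, L x u = 0 ∧ q u = v := by
  obtain ⟨M, hMc, hM1, hM⟩ := exists_ker_transport L hL x₀ q hq2
  have hinv : ContinuousAt (fun x => Ring.inverse (M x) v) x₀ := by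
    have h1 : ContinuousAt (Ring.inverse : (E →L[ℂ] E) → _) (M x₀) := by
      rw [hM1]
      exact NormedRing.inverse_continuousAt 1
    exact (h1.comp hMc.continuousAt).clm_apply continuousAt_const
  have hU' : U ∈ 𝓝 (Ring.inverse (M x₀) v) := by simpa [hM1] using hU
  filter_upwards [eventually_isUnit_of_eq_one hMc hM1, hinv.eventually_mem hU'] with x hx hxU hd
  let T := (M x : E →ₗ[ℂ] E).restrict (p := LinearMap.ker (L x : E →ₗ[ℂ] F))
      (q := LinearMap.ker (L x₀ : E →ₗ[ℂ] F)) fun v hv => by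
    have : L x v = 0 := by simpa using hv
    simp [hM x v this, hq1]
  have hT : Function.Injective T := fun a b hab =>
    Subtype.ext (isUnit_clm_injective hx (congrArg Subtype.val hab))
  -- Equal dimensions make the embedding of kernels onto, so `v` has a preimage in the kernel of `L
  -- x`. It is the inverse of `M x` applied to `v`, which depends continuously on `x`.
  have hTs : Function.Surjective T :=
    (LinearMap.injective_iff_surjective_of_finrank_eq_finrank hd).1 hT
  obtain ⟨⟨u, hu⟩, hTu⟩ := hTs ⟨v, by simpa using hv⟩
  have hMu : M x u = v := congrArg Subtype.val hTu
  have hLu : L x u = 0 := by simpa using hu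
  refine ⟨u, ?_, hLu, by rw [← hM x u hLu, hMu]⟩
  have : Ring.inverse (M x) v = u := by
    rw [← hMu, ← mul_apply_eq_comp, Ring.inverse_mul_cancel _ hx]
    rfl
  rwa [← this]

end KernelPerturbation

/-! ### A chart that straightens a union of conjugacy classes. -/

section Straightening

open Topology Filter

variable {A : Type*} [NormedRing A] [NormedAlgebra ℂ A]

/-- The linear map `t ↦ b * t - t * c`. -/
def intertwine (b c : A) : A →L[ℂ] A :=
  ContinuousLinearMap.mul ℂ A b - (ContinuousLinearMap.mul ℂ A).flip c

@[simp]
theorem intertwine_apply (b c t : A) : intertwine b c t = b * t - t * c := rfl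

theorem continuous_intertwine : Continuous fun x : A × A => intertwine x.1 x.2 := by
  unfold intertwine
  fun_prop

/-- The coordinates used to straighten a conjugacy class: every `v` is the sum of a
commutator, an element of `P` and a remainder. -/
theorem exists_commutator_decomposition (a : A) (P : Submodule ℂ A)
    (hP : Disjoint (LinearMap.range (intertwine a a : A →ₗ[ℂ] A)) P)
    (q : A →ₗ[ℂ] A) (hq1 : ∀ v, intertwine a a (q v) = 0)
    (hq2 : ∀ v, intertwine a a v = 0 → q v = v) :
    ∃ α β γ : A →ₗ[ℂ] A, (∀ v, α v * a - a * α v + β v + γ v = v) ∧ (∀ v, β v ∈ P) ∧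
      (∀ v ∈ LinearMap.range (intertwine a a : A →ₗ[ℂ] A) ⊔ P, γ v = 0) ∧
      (∀ t, q t = 0 → ∀ D ∈ P,
        α (t * a - a * t + D) = t ∧ β (t * a - a * t + D) = D) := by
  set R := LinearMap.range (intertwine a a : A →ₗ[ℂ] A) with hR
  obtain ⟨ρ, hρ1, hρ2, hρ3⟩ := exists_linearMap_projection hP
  obtain ⟨π, hπ1, hπ2, -⟩ := exists_linearMap_projection (disjoint_bot_right (a := P))
  obtain ⟨s, hs⟩ := exists_generalizedInverse (intertwine a a : A →ₗ[ℂ] A) q hq2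
  have had : ∀ t, t * a - a * t = - intertwine a a t := fun t => by simp
  have hmem : ∀ t, intertwine a a t ∈ R := fun t => ⟨t, rfl⟩
  refine ⟨-(s ∘ₗ ρ), π ∘ₗ (LinearMap.id - ρ), (LinearMap.id - ρ) - π ∘ₗ (LinearMap.id - ρ),
    fun v => ?_, fun v => hπ1 _, fun v hv => ?_, fun t ht D hD => ?_⟩
  · obtain ⟨w, hw⟩ := hρ1 v
    have h1 : intertwine a a (s (ρ v)) = ρ v := by
      rw [← hw, hs, map_sub, hq1, sub_zero]
      rfl
    rw [had]
    simp only [LinearMap.neg_apply, LinearMap.comp_apply, LinearMap.sub_apply, map_neg, h1,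
      LinearMap.id_apply]
    abel
  · obtain ⟨r, hr, D, hD, rfl⟩ := Submodule.mem_sup.1 hv
    simp [hρ2 r hr, hρ3 D hD, hπ2 D hD]
  -- A commutator determines `t` only modulo the centralizer; the normalization `q t = 0` removes
  -- this ambiguity.
  · have h1 : s (intertwine a a t) = t := by
      have := hs t
      rw [ht, sub_zero] at this
      exact this
    rw [had]
    simp [-intertwine_apply, hρ2 _ (hmem t), hρ3 D hD, hπ2 D hD, h1]

/-- The map that parametrizes a neighbourhood of `a` by commutator directions, an affine space
through `a` and a complement. -/
def sliceMap (a : A) (α β γ : A →L[ℂ] A) (v : A) : A :=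
  (1 + α v) * (a + β v + γ v) * Ring.inverse (1 + α v)

theorem contDiffAt_sliceMap [FiniteDimensional ℂ A] (a : A) (α β γ : A →L[ℂ] A) :
    ContDiffAt ℂ 1 (sliceMap a α β γ) 0 := by
  have : CompleteSpace A := FiniteDimensional.complete ℂ A
  unfold sliceMap
  refine ContDiffAt.mul (by fun_prop) ?_
  have h : ContDiffAt ℂ 1 (Ring.inverse : A → A) (1 + α 0) := by
    simpa using contDiffAt_ringInverse ℂ (1 : Aˣ)
  exact h.comp (0 : A) (f := fun v => 1 + α v) (by fun_prop)

/-- The product rule gives `α v * a - a * α v + β v + γ v`, so the decomposition of `v` is exactly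
what makes the derivative the identity and the inverse function theorem applicable. -/
theorem hasFDerivAt_sliceMap [FiniteDimensional ℂ A] (a : A) (α β γ : A →L[ℂ] A)
    (h : ∀ v, α v * a - a * α v + β v + γ v = v) :
    HasFDerivAt (sliceMap a α β γ) (ContinuousLinearMap.id ℂ A) 0 := by
  have : CompleteSpace A := FiniteDimensional.complete ℂ A
  have h1 : HasFDerivAt (fun v => 1 + α v) α 0 := α.hasFDerivAt.const_add 1
  have h2 : HasFDerivAt (fun v => a + β v + γ v) (β + γ) 0 :=
    (β.hasFDerivAt.const_add a).add γ.hasFDerivAt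
  have h3 : HasFDerivAt (fun v => Ring.inverse (1 + α v))
      ((-ContinuousLinearMap.mulLeftRight ℂ A 1 1).comp α) 0 := by
    have h0 := hasFDerivAt_ringInverse (𝕜 := ℂ) (1 : Aˣ)
    have h0' : HasFDerivAt (Ring.inverse : A → A) (-ContinuousLinearMap.mulLeftRight ℂ A 1 1)
        (1 + α 0) := by simpa using h0
    exact h0'.comp (0 : A) h1
  refine ((h1.mul' h2).mul' h3).congr_fderiv ?_
  ext v
  simp
  conv_rhs => rw [← h v]
  abel

/-- A union of conjugacy classes that meets a neighbourhood of `a` in the classes of the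
points of an affine space `a + P` transversal to the class of `a`, along which the dimension of
the centralizer is constant, is a submanifold near `a`. -/
theorem exists_straightening [FiniteDimensional ℂ A] (S : Set A) (a : A) (P : Submodule ℂ A)
    (hP : Disjoint (LinearMap.range (intertwine a a : A →ₗ[ℂ] A)) P)
    (h1 : ∀ᶠ D in 𝓝 (0 : A), D ∈ P → ∀ u : Aˣ, (u : A) * (a + D) * (↑u⁻¹ : A) ∈ S)
    (h2 : ∀ U ∈ 𝓝 (0 : A), ∀ᶠ b in 𝓝 a, b ∈ S → ∃ D ∈ P, D ∈ U ∧
      Module.finrank ℂ (LinearMap.ker (intertwine b (a + D) : A →ₗ[ℂ] A)) =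
        Module.finrank ℂ (LinearMap.ker (intertwine a a : A →ₗ[ℂ] A))) :
    ∃ (φ : OpenPartialHomeomorph A A),
      a ∈ φ.source ∧ DifferentiableOn ℂ φ φ.source ∧ DifferentiableOn ℂ φ.symm φ.target ∧
      ∀ y ∈ φ.source,
        y ∈ S ↔ φ y ∈ LinearMap.range (intertwine a a : A →ₗ[ℂ] A) ⊔ P := by
  have : CompleteSpace A := FiniteDimensional.complete ℂ A
  obtain ⟨q, hq1, hq2⟩ := exists_projection_ker (intertwine a a)
  obtain ⟨α', β', γ', hd, hβ', hγ', hinv'⟩ := exists_commutator_decomposition a P hP q hq1 hq2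
  obtain ⟨α, rfl⟩ : ∃ α : A →L[ℂ] A, (α : A →ₗ[ℂ] A) = α' :=
    ⟨LinearMap.toContinuousLinearMap α', rfl⟩
  obtain ⟨β, rfl⟩ : ∃ α : A →L[ℂ] A, (α : A →ₗ[ℂ] A) = β' :=
    ⟨LinearMap.toContinuousLinearMap β', rfl⟩
  obtain ⟨γ, rfl⟩ : ∃ α : A →L[ℂ] A, (α : A →ₗ[ℂ] A) = γ' :=
    ⟨LinearMap.toContinuousLinearMap γ', rfl⟩
  simp only [ContinuousLinearMap.coe_coe] at hd hβ' hγ' hinv'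
  have hcd := contDiffAt_sliceMap a α β γ
  have hfd : HasFDerivAt (sliceMap a α β γ)
      ((ContinuousLinearEquiv.refl ℂ A : A ≃L[ℂ] A) : A →L[ℂ] A) 0 :=
    hasFDerivAt_sliceMap a α β γ hd
  let Φ := hcd.toOpenPartialHomeomorph _ hfd one_ne_zero
  have hΦ : ∀ v, Φ v = sliceMap a α β γ v := fun v => rfl
  have h0 : (0 : A) ∈ Φ.source := hcd.mem_toOpenPartialHomeomorph_source hfd one_ne_zero
  have hΦ0 : Φ 0 = a := by simp [hΦ, sliceMap]
  have haT : a ∈ Φ.target := hΦ0 ▸ Φ.map_source h0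
  have hsa : Φ.symm a = 0 := by rw [← hΦ0, Φ.left_inv h0]
  have hsc : ContDiffAt ℂ 1 Φ.symm a := by
    have := hcd.to_localInverse hfd one_ne_zero
    rw [← hΦ, hΦ0] at this
    exact this
  have hscont : ContinuousAt Φ.symm a := hsc.continuousAt
  -- conditions on the chart coordinate
  have e1 : ∀ᶠ v in 𝓝 (0 : A), DifferentiableAt ℂ (sliceMap a α β γ) v :=
    (hcd.eventually (by simp)).mono fun v hv => hv.differentiableAt one_ne_zero
  have e2 : ∀ᶠ v in 𝓝 (0 : A), IsUnit (1 + α v) :=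
    eventually_isUnit_of_eq_one (by fun_prop) (by simp)
  have e3 : ∀ᶠ v in 𝓝 (0 : A), ∀ u : Aˣ, (u : A) * (a + β v) * (↑u⁻¹ : A) ∈ S := by
    have hc : Tendsto β (𝓝 0) (𝓝 0) := by
      simpa using β.continuous.tendsto 0
    exact (hc.eventually h1).mono fun v hv => hv (hβ' v)
  -- conditions on the point
  have e4 : ∀ᶠ y in 𝓝 a, DifferentiableAt ℂ Φ.symm y :=
    (hsc.eventually (by simp)).mono fun v hv => hv.differentiableAt one_ne_zero
  have e5 : ∀ᶠ y in 𝓝 a, y ∈ S → ∃ t D : A, q t = 0 ∧ D ∈ P ∧ IsUnit (1 + t) ∧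
      t * a - a * t + D ∈ Φ.source ∧ y * (1 + t) = (1 + t) * (a + D) := by
    have hcont : Continuous fun x : A × A => (x.1 - 1) * a - a * (x.1 - 1) + x.2 := by fun_prop
    have hmem : ∀ᶠ x in 𝓝 ((1 : A), (0 : A)),
        IsUnit x.1 ∧ (x.1 - 1) * a - a * (x.1 - 1) + x.2 ∈ Φ.source := by
      refine (eventually_isUnit_of_eq_one (x₀ := ((1 : A), (0 : A))) continuous_fst rfl).and ?_
      exact hcont.continuousAt.eventually_mem (Φ.open_source.mem_nhds (by simpa using h0))
    rw [nhds_prod_eq] at hmem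
    obtain ⟨p1, hp1, p2, hp2, hp⟩ := eventually_prod_iff.1 hmem
    have hL : Continuous fun x : A × A => intertwine x.1 (a + x.2) :=
      continuous_intertwine.comp (by fun_prop : Continuous fun x : A × A => (x.1, a + x.2))
    -- At `(a, 0)` the element 1 is an intertwiner. Where the dimension is unchanged it can be
    -- followed to an intertwiner `u` near 1, hence to an invertible one.
    have hlift := eventually_exists_mem_ker (fun x : A × A => intertwine x.1 (a + x.2)) hL
      (a, 0) q (by simpa using hq1) (by simpa using hq2) 1 (by simp) {u | p1 u} hp1
    rw [nhds_prod_eq] at hlift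
    obtain ⟨r1, hr1, r2, hr2, hr⟩ := eventually_prod_iff.1 hlift
    filter_upwards [h2 {D | p2 D ∧ r2 D} (hp2.and hr2), hr1] with y hy hyr hyS
    obtain ⟨D, hDP, ⟨hD2, hDr⟩, hfr⟩ := hy hyS
    obtain ⟨u, hu1, hu2, hu3⟩ := hr hyr hDr (hfr.trans (by rw [add_zero]))
    obtain ⟨hu, hsrc⟩ := hp hu1 hD2
    have hq1' : q 1 = 1 := hq2 1 (by simp)
    -- Since `q u = 1 = q 1`, the element `t = u - 1` is normalized, so `t` and `D` can be recovered
    -- from the coordinate `t * a - a * t + D`.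
    refine ⟨u - 1, D, by rw [map_sub, hu3, hq1', sub_self], hDP, by simpa using hu, hsrc, ?_⟩
    simpa [sub_eq_zero] using hu2
  have e123 := hscont.eventually ((hsa.symm ▸ (e1.and (e2.and e3))))
  obtain ⟨N, hN, hNo, haN⟩ := eventually_nhds_iff.1 (e123.and (e4.and e5))
  -- The chart is the local inverse of the slice map. On `range (ad a) ⊔ P` the remainder `γ`
  -- vanishes, so the slice map takes values in conjugates of `a + P`.
  refine ⟨Φ.symm.restrOpen N hNo, ⟨haT, haN⟩, ?_, ?_, ?_⟩
  · rintro y ⟨-, hy⟩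
    exact (hN y hy).2.1.differentiableWithinAt
  · intro v hv
    have hv' : v ∈ Φ.source ∧ Φ v ∈ N := by simpa using hv
    have := (hN _ hv'.2).1.1
    rw [Φ.left_inv hv'.1] at this
    exact this.differentiableWithinAt
  · rintro y ⟨hyT, hy⟩
    have hyT' : y ∈ Φ.target := hyT
    obtain ⟨⟨-, hun, hS⟩, -, hlift⟩ := hN y hy
    change y ∈ S ↔ Φ.symm y ∈ _
    constructor
    · intro hyS
      obtain ⟨t, D, ht, hD, htu, hsrc, heq⟩ := hlift hyS
      obtain ⟨i1, i2⟩ := hinv' t ht D hD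
      have hV : t * a - a * t + D ∈ LinearMap.range (intertwine a a : A →ₗ[ℂ] A) ⊔ P :=
        Submodule.add_mem_sup ⟨-t, by simp; abel⟩ hD
      have : Φ (t * a - a * t + D) = y := by
        rw [hΦ, sliceMap, hγ' _ hV, i1, i2, add_zero, ← heq, mul_assoc,
          Ring.mul_inverse_cancel _ htu, mul_one]
      rw [← this, Φ.left_inv hsrc]
      exact hV
    · intro hV
      have h3 : Φ (Φ.symm y) = y := Φ.right_inv hyT'
      rw [hΦ, sliceMap, hγ' _ hV, add_zero] at h3
      obtain ⟨u, hu⟩ := hun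
      rw [← h3, ← hu, Ring.inverse_unit]
      exact hS u

end Straightening
-- Intertwiners of matrices and their invariance under similarity.
section Sylvester

variable {m m' n n' : Type*} [Fintype m] [Fintype m'] [Fintype n] [Fintype n']

/-- The linear map `X ↦ B * X - X * C` on rectangular matrices. -/
def sylvester (B : Matrix m m ℂ) (C : Matrix n n ℂ) : Matrix m n ℂ →ₗ[ℂ] Matrix m n ℂ where
  toFun X := B * X - X * C
  map_add' X Y := by rw [Matrix.mul_add, Matrix.add_mul]; abel
  map_smul' c X := by simp [smul_sub]

theorem sylvester_apply (B : Matrix m m ℂ) (C : Matrix n n ℂ) (X : Matrix m n ℂ) :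
    sylvester B C X = B * X - X * C := rfl

theorem mem_ker_sylvester {B : Matrix m m ℂ} {C : Matrix n n ℂ} {X : Matrix m n ℂ} :
    X ∈ LinearMap.ker (sylvester B C) ↔ B * X = X * C := by
  rw [LinearMap.mem_ker, sylvester_apply, sub_eq_zero]

/-- Similarity of square matrices with possibly different index types. -/
def RectSimilar [DecidableEq m] [DecidableEq m'] (A : Matrix m m ℂ) (J : Matrix m' m' ℂ) : Prop :=
  ∃ (U : Matrix m m' ℂ) (V : Matrix m' m ℂ), U * V = 1 ∧ V * U = 1 ∧ A * U = U * J

namespace RectSimilar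

variable [DecidableEq m] [DecidableEq m'] [DecidableEq n] [DecidableEq n']

theorem symm {A : Matrix m m ℂ} {J : Matrix m' m' ℂ} (h : RectSimilar A J) :
    RectSimilar J A := by
  obtain ⟨U, V, h1, h2, h3⟩ := h
  refine ⟨V, U, h2, h1, ?_⟩
  calc J * V = V * U * J * V := by rw [h2, Matrix.one_mul]
    _ = V * (U * J) * V := by simp only [Matrix.mul_assoc]
    _ = V * A * (U * V) := by rw [← h3]; simp only [Matrix.mul_assoc]
    _ = V * A := by rw [h1, Matrix.mul_one]

theorem trans {A : Matrix m m ℂ} {B : Matrix m' m' ℂ} {C : Matrix n n ℂ}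
    (h : RectSimilar A B) (h' : RectSimilar B C) : RectSimilar A C := by
  obtain ⟨U, V, h1, h2, h3⟩ := h
  obtain ⟨U', V', h1', h2', h3'⟩ := h'
  refine ⟨U * U', V' * V, ?_, ?_, ?_⟩
  · rw [Matrix.mul_assoc, ← Matrix.mul_assoc U', h1', Matrix.one_mul, h1]
  · rw [Matrix.mul_assoc, ← Matrix.mul_assoc V, h2, Matrix.one_mul, h2']
  · rw [← Matrix.mul_assoc, h3, Matrix.mul_assoc, h3', Matrix.mul_assoc]

theorem submatrix (J : Matrix m' m' ℂ) (e : m ≃ m') : RectSimilar (J.submatrix e e) J := by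
  refine ⟨(1 : Matrix m' m' ℂ).submatrix e id, (1 : Matrix m' m' ℂ).submatrix id e, ?_, ?_, ?_⟩
  · rw [← Matrix.submatrix_mul _ _ _ _ _ Function.bijective_id, Matrix.mul_one,
      Matrix.submatrix_one_equiv]
  · rw [← Matrix.submatrix_mul _ _ _ _ _ e.bijective, Matrix.mul_one, Matrix.submatrix_id_id]
  · rw [← Matrix.submatrix_mul _ _ _ _ _ e.bijective, Matrix.mul_one]
    conv_rhs => rw [← Matrix.submatrix_id_id J,
      ← Matrix.submatrix_mul _ _ _ _ _ Function.bijective_id, Matrix.one_mul]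

theorem conj (A : Matrix m m ℂ) (T : GL m ℂ) :
    RectSimilar ((T : Matrix m m ℂ) * A * ((T⁻¹ : GL m ℂ) : Matrix m m ℂ)) A := by
  refine ⟨T, (T⁻¹ : GL m ℂ), ?_, ?_, ?_⟩
  · rw [← Units.val_mul, mul_inv_cancel, Units.val_one]
  · rw [← Units.val_mul, inv_mul_cancel, Units.val_one]
  · rw [Matrix.mul_assoc, ← Units.val_mul, inv_mul_cancel, Units.val_one, Matrix.mul_one]

theorem finrank_ker_sylvester_le {A : Matrix m m ℂ} {J : Matrix m' m' ℂ} {B : Matrix n n ℂ}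
    {K : Matrix n' n' ℂ} (h : RectSimilar A J) (h' : RectSimilar B K) :
    Module.finrank ℂ (LinearMap.ker (sylvester A B)) ≤
      Module.finrank ℂ (LinearMap.ker (sylvester J K)) := by
  obtain ⟨U, V, h1, h2, h3⟩ := h.symm
  obtain ⟨U', V', h1', h2', h3'⟩ := h'
  let f : Matrix m n ℂ →ₗ[ℂ] Matrix m' n' ℂ :=
    { toFun := fun X => U * X * U'
      map_add' := fun X Y => by rw [Matrix.mul_add, Matrix.add_mul]
      map_smul' := fun c X => by simp }
  refine LinearMap.finrank_le_finrank_of_injective (f := f.restrict fun X hX => ?_) ?_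
  · rw [mem_ker_sylvester] at hX ⊢
    change J * (U * X * U') = U * X * U' * K
    calc J * (U * X * U') = J * U * X * U' := by simp only [Matrix.mul_assoc]
      _ = U * (A * X) * U' := by rw [h3]; simp only [Matrix.mul_assoc]
      _ = U * X * (B * U') := by rw [hX]; simp only [Matrix.mul_assoc]
      _ = _ := by rw [h3']; simp only [Matrix.mul_assoc]
  · have key : ∀ X, V * (f X) * V' = X := fun X => by
      change V * (U * X * U') * V' = X
      calc V * (U * X * U') * V' = (V * U) * X * (U' * V') := by simp only [Matrix.mul_assoc]
        _ = X := by rw [h2, h1', Matrix.one_mul, Matrix.mul_one]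
    intro X Y hXY
    have : f X = f Y := congrArg Subtype.val hXY
    exact Subtype.ext (by rw [← key X, ← key Y, this])

theorem finrank_ker_sylvester_eq {A : Matrix m m ℂ} {J : Matrix m' m' ℂ} {B : Matrix n n ℂ}
    {K : Matrix n' n' ℂ} (h : RectSimilar A J) (h' : RectSimilar B K) :
    Module.finrank ℂ (LinearMap.ker (sylvester A B)) =
      Module.finrank ℂ (LinearMap.ker (sylvester J K)) :=
  le_antisymm (finrank_ker_sylvester_le h h') (finrank_ker_sylvester_le h.symm h'.symm)

end RectSimilar

end Sylvester

/-! ### Intertwiners of Jordan blocks and of block diagonal matrices. -/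

section JordanBlocks

variable {k l : ℕ}

/-- The extension of a matrix by zero to all pairs of natural numbers. -/
def zeroExtend (X : Matrix (Fin k) (Fin l) ℂ) (s t : ℕ) : ℂ :=
  if h : s < k ∧ t < l then X ⟨s, h.1⟩ ⟨t, h.2⟩ else 0

theorem zeroExtend_coe (X : Matrix (Fin k) (Fin l) ℂ) (s : Fin k) (t : Fin l) :
    zeroExtend X s t = X s t := by simp [zeroExtend]

theorem zeroExtend_of_le_left (X : Matrix (Fin k) (Fin l) ℂ) {s t : ℕ} (h : k ≤ s) :
    zeroExtend X s t = 0 := by simp [zeroExtend, not_lt.2 h]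

theorem jordanBlock_mul_apply (z : ℂ) (X : Matrix (Fin k) (Fin l) ℂ) (s : Fin k) (t : Fin l) :
    (jordanBlock k z * X) s t = z * zeroExtend X s t + zeroExtend X (s + 1) t := by
  have h1 : ∀ u : Fin k, jordanBlock k z s u * X u t =
      (if s = u then z * X u t else 0) + (if (s : ℕ) + 1 = (u : ℕ) then X u t else 0) := by
    intro u
    by_cases h : s = u
    · subst h; simp [jordanBlock]
    · by_cases h' : (s : ℕ) + 1 = (u : ℕ) <;> simp [jordanBlock, h, h']
  rw [Matrix.mul_apply, Finset.sum_congr rfl fun u _ => h1 u, Finset.sum_add_distrib,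
    Finset.sum_ite_eq Finset.univ s, if_pos (Finset.mem_univ _), zeroExtend_coe]
  congr 1
  by_cases h : (s : ℕ) + 1 < k
  · have h2 : ∀ u : Fin k, ((s : ℕ) + 1 = (u : ℕ)) ↔ (⟨s + 1, h⟩ : Fin k) = u := fun u => by
      rw [Fin.ext_iff]
    simp_rw [h2]
    rw [Finset.sum_ite_eq Finset.univ, if_pos (Finset.mem_univ _)]
    simp [zeroExtend, h]
  · rw [zeroExtend_of_le_left X (not_lt.1 h)]
    exact Finset.sum_eq_zero fun u _ => if_neg (by omega)

theorem mul_jordanBlock_apply (w : ℂ) (X : Matrix (Fin k) (Fin l) ℂ) (s : Fin k) (t : Fin l) :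
    (X * jordanBlock l w) s t =
      w * zeroExtend X s t + if (t : ℕ) = 0 then 0 else zeroExtend X s (t - 1) := by
  have h1 : ∀ u : Fin l, X s u * jordanBlock l w u t =
      (if t = u then w * X s u else 0) + (if (u : ℕ) + 1 = (t : ℕ) then X s u else 0) := by
    intro u
    by_cases h : t = u
    · subst h; simp [jordanBlock, mul_comm]
    · by_cases h' : (u : ℕ) + 1 = (t : ℕ) <;> simp [jordanBlock, h, Ne.symm h, h']
  rw [Matrix.mul_apply, Finset.sum_congr rfl fun u _ => h1 u, Finset.sum_add_distrib,
    Finset.sum_ite_eq Finset.univ t, if_pos (Finset.mem_univ _), zeroExtend_coe]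
  congr 1
  have ht := t.2
  split_ifs with h
  · exact Finset.sum_eq_zero fun u _ => if_neg (by omega)
  · have h2 : ∀ u : Fin l, ((u : ℕ) + 1 = (t : ℕ)) ↔ (⟨t - 1, by omega⟩ : Fin l) = u := fun u => by
      rw [Fin.ext_iff]
      simp only
      omega
    simp_rw [h2]
    rw [Finset.sum_ite_eq Finset.univ, if_pos (Finset.mem_univ _)]
    simp [zeroExtend, show (t : ℕ) - 1 < l by omega]

theorem mem_ker_sylvester_jordanBlock {z w : ℂ} {X : Matrix (Fin k) (Fin l) ℂ} :
    X ∈ LinearMap.ker (sylvester (jordanBlock k z) (jordanBlock l w)) ↔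
      ∀ s < k, ∀ t < l, z * zeroExtend X s t + zeroExtend X (s + 1) t =
        w * zeroExtend X s t + if t = 0 then 0 else zeroExtend X s (t - 1) := by
  rw [mem_ker_sylvester, ← Matrix.ext_iff]
  constructor
  · intro h s hs t ht
    simpa only [jordanBlock_mul_apply, mul_jordanBlock_apply] using h ⟨s, hs⟩ ⟨t, ht⟩
  · intro h s t
    rw [jordanBlock_mul_apply, mul_jordanBlock_apply]
    exact h s s.2 t t.2

/-- Entrywise, `(z - w) X s t = X s (t - 1) - X (s + 1) t`, so the entries vanish by induction over
the columns from the left and the rows from the bottom. In `key`, `d` bounds the distance of row `s`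
from the bottom. -/
theorem ker_sylvester_jordanBlock_of_ne {z w : ℂ} (hzw : z ≠ w) :
    LinearMap.ker (sylvester (jordanBlock k z) (jordanBlock l w)) = ⊥ := by
  rw [eq_bot_iff]
  intro X hX
  rw [mem_ker_sylvester_jordanBlock] at hX
  have hzw' : z - w ≠ 0 := sub_ne_zero.2 hzw
  have key : ∀ t < l, ∀ d s, k ≤ s + d → zeroExtend X s t = 0 := by
    intro t
    induction t with
    | zero =>
      intro ht d
      induction d with
      | zero => intro s hs; exact zeroExtend_of_le_left X hs
      | succ d ih =>
        intro s hs
        by_cases hsk : s < k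
        · have := hX s hsk 0 ht
          rw [ih (s + 1) (by omega), if_pos rfl] at this
          exact (mul_eq_zero.1 (by linear_combination this : (z - w) * zeroExtend X s 0 = 0)
            ).resolve_left hzw'
        · exact zeroExtend_of_le_left X (not_lt.1 hsk)
    | succ t iht =>
      intro ht d
      induction d with
      | zero => intro s hs; exact zeroExtend_of_le_left X hs
      | succ d ih =>
        intro s hs
        by_cases hsk : s < k
        · have := hX s hsk (t + 1) ht
          rw [ih (s + 1) (by omega), if_neg (by omega), Nat.add_sub_cancel,
            iht (by omega) k s (by omega)] at this
          exact (mul_eq_zero.1 (by linear_combination this :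
            (z - w) * zeroExtend X s (t + 1) = 0)).resolve_left hzw'
        · exact zeroExtend_of_le_left X (not_lt.1 hsk)
  refine Matrix.ext fun s t => ?_
  rw [← zeroExtend_coe X, key t t.2 k s (by omega)]
  rfl

/-- The upper triangular Toeplitz matrix with last column starting with `c`. -/
def toeplitzMap (k l : ℕ) : (Fin (min k l) → ℂ) →ₗ[ℂ] Matrix (Fin k) (Fin l) ℂ where
  toFun c := Matrix.of fun s t =>
    if h : (s : ℕ) + (l - 1 - t) < min k l then c ⟨_, h⟩ else 0
  map_add' c d := by
    ext s t
    simp only [Matrix.of_apply, Matrix.add_apply, Pi.add_apply]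
    split_ifs <;> simp
  map_smul' r c := by
    ext s t
    simp only [Matrix.of_apply, Matrix.smul_apply, Pi.smul_apply]
    split_ifs <;> simp

theorem zeroExtend_toeplitzMap (c : Fin (min k l) → ℂ) {s t : ℕ} (ht : t < l) :
    zeroExtend (toeplitzMap k l c) s t =
      if h : s + (l - 1 - t) < min k l then c ⟨_, h⟩ else 0 := by
  by_cases hs : s < k
  · simp [zeroExtend, hs, ht, toeplitzMap]
  · rw [zeroExtend_of_le_left _ (not_lt.1 hs), dif_neg (by omega)]

theorem toeplitzMap_injective : Function.Injective (toeplitzMap k l) := by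
  intro c d hcd
  ext ⟨i, hi⟩
  have hl : l - 1 < l := by omega
  have h := congrArg (fun X => zeroExtend X i (l - 1)) hcd
  simp only [zeroExtend_toeplitzMap _ hl, Nat.sub_self, add_zero, dif_pos hi] at h
  exact h

/-- For equal eigenvalues the diagonal terms cancel and the equation says `X (s + 1) t = X s (t -
1)`, with zeros outside the matrix: `X` is constant along diagonals and determined by its last
column. The boundary zeros leave `min k l` free entries. -/
theorem range_toeplitzMap (z : ℂ) : LinearMap.range (toeplitzMap k l) =
    LinearMap.ker (sylvester (jordanBlock k z) (jordanBlock l z)) := by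
  ext X
  rw [mem_ker_sylvester_jordanBlock]
  constructor
  · rintro ⟨c, rfl⟩ s hs t ht
    congr 1
    rw [zeroExtend_toeplitzMap c ht]
    split_ifs with h1 h2 h2
    · omega
    · rw [zeroExtend_toeplitzMap c (by omega), dif_pos (by omega)]
      congr 2
      omega
    · rfl
    · rw [zeroExtend_toeplitzMap c (by omega), dif_neg (by omega)]
  · intro hX
    have rel : ∀ s < k, ∀ t < l, zeroExtend X (s + 1) t =
        if t = 0 then 0 else zeroExtend X s (t - 1) := fun s hs t ht =>
      add_left_cancel (hX s hs t ht)
    have low : ∀ t < l, ∀ s, t < s → zeroExtend X s t = 0 := by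
      intro t
      induction t with
      | zero =>
        intro ht s hs
        obtain ⟨s, rfl⟩ := Nat.exists_eq_succ_of_ne_zero hs.ne'
        by_cases hsk : s < k
        · exact rel s hsk 0 ht
        · exact zeroExtend_of_le_left X (by omega)
      | succ t ih =>
        intro ht s hs
        obtain ⟨s, rfl⟩ := Nat.exists_eq_succ_of_ne_zero (show s ≠ 0 by omega)
        by_cases hsk : s < k
        · rw [Nat.succ_eq_add_one, rel s hsk (t + 1) ht, if_neg (by omega)]
          exact ih (by omega) s (by omega)
        · exact zeroExtend_of_le_left X (by omega)
    have diag : ∀ d s t, t + d < l → zeroExtend X s t = zeroExtend X (s + d) (t + d) := by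
      intro d
      induction d with
      | zero => intro s t _; rfl
      | succ d ih =>
        intro s t ht
        rw [ih s t (by omega)]
        by_cases hsk : s + d < k
        · have := rel (s + d) hsk (t + d + 1) (by omega)
          rw [if_neg (by omega), Nat.add_sub_cancel] at this
          exact this.symm
        · rw [zeroExtend_of_le_left X (by omega), zeroExtend_of_le_left X (by omega)]
    refine ⟨fun i => zeroExtend X i (l - 1), ?_⟩
    refine Matrix.ext fun s t => ?_
    have ht := t.2
    rw [← zeroExtend_coe (toeplitzMap k l _), zeroExtend_toeplitzMap _ ht, ← zeroExtend_coe X,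
      diag (l - 1 - t) s t (by omega), show (t : ℕ) + (l - 1 - t) = l - 1 by omega]
    split_ifs with h
    · rfl
    · symm
      by_cases hk : k ≤ (s : ℕ) + (l - 1 - t)
      · exact zeroExtend_of_le_left X hk
      · exact low _ (by omega) _ (by omega)

theorem finrank_ker_sylvester_jordanBlock (z w : ℂ) :
    Module.finrank ℂ (LinearMap.ker (sylvester (jordanBlock k z) (jordanBlock l w))) =
      if z = w then min k l else 0 := by
  split_ifs with h
  · subst h
    rw [← range_toeplitzMap, LinearMap.finrank_range_of_inj toeplitzMap_injective]
    simp
  · rw [ker_sylvester_jordanBlock_of_ne h]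
    simp

variable {ι κ : Type*} [Fintype ι] [DecidableEq ι] [Fintype κ] [DecidableEq κ]

theorem blockDiagonal'_mul_apply {m : ι → Type*} {m' : Type*} [∀ i, Fintype (m i)]
    (B : ∀ i, Matrix (m i) (m i) ℂ) (X : Matrix (Σ i, m i) m' ℂ) (i : ι) (s : m i) (t : m') :
    (Matrix.blockDiagonal' B * X) ⟨i, s⟩ t = (B i * Matrix.of fun u v => X ⟨i, u⟩ v) s t := by
  rw [Matrix.mul_apply, Fintype.sum_sigma, Finset.sum_eq_single i]
  · simp [Matrix.mul_apply, Matrix.blockDiagonal'_apply_eq]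
  · intro j _ hj
    exact Finset.sum_eq_zero fun u _ => by
      rw [Matrix.blockDiagonal'_apply_ne _ _ _ (Ne.symm hj), zero_mul]
  · simp

theorem mul_blockDiagonal'_apply {m : ι → Type*} {m' : Type*} [∀ i, Fintype (m i)]
    (B : ∀ i, Matrix (m i) (m i) ℂ) (X : Matrix m' (Σ i, m i) ℂ) (i : ι) (s : m') (t : m i) :
    (X * Matrix.blockDiagonal' B) s ⟨i, t⟩ = ((Matrix.of fun u v => X u ⟨i, v⟩) * B i) s t := by
  rw [Matrix.mul_apply, Fintype.sum_sigma, Finset.sum_eq_single i]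
  · simp [Matrix.mul_apply, Matrix.blockDiagonal'_apply_eq]
  · intro j _ hj
    exact Finset.sum_eq_zero fun u _ => by
      rw [Matrix.blockDiagonal'_apply_ne _ _ _ hj, mul_zero]
  · simp

theorem mem_ker_sylvester_blockDiagonal' {m : ι → Type*} {n : κ → Type*} [∀ i, Fintype (m i)]
    [∀ i, Fintype (n i)] {B : ∀ i, Matrix (m i) (m i) ℂ} {C : ∀ i, Matrix (n i) (n i) ℂ}
    {X : Matrix (Σ i, m i) (Σ i, n i) ℂ} :
    X ∈ LinearMap.ker (sylvester (Matrix.blockDiagonal' B) (Matrix.blockDiagonal' C)) ↔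
      ∀ i j, (Matrix.of fun s t => X ⟨i, s⟩ ⟨j, t⟩) ∈
        LinearMap.ker (sylvester (B i) (C j)) := by
  simp_rw [mem_ker_sylvester, ← Matrix.ext_iff]
  constructor
  · intro h i j s t
    have := h ⟨i, s⟩ ⟨j, t⟩
    rw [blockDiagonal'_mul_apply, mul_blockDiagonal'_apply] at this
    simpa [Matrix.mul_apply] using this
  · rintro h ⟨i, s⟩ ⟨j, t⟩
    rw [blockDiagonal'_mul_apply, mul_blockDiagonal'_apply]
    simpa [Matrix.mul_apply] using h i j s t

/-- Intertwiners of block diagonal matrices are families of intertwiners of the blocks. -/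
def kerSylvesterBlockDiagonalEquiv {m : ι → Type*} {n : κ → Type*} [∀ i, Fintype (m i)]
    [∀ i, Fintype (n i)] (B : ∀ i, Matrix (m i) (m i) ℂ) (C : ∀ i, Matrix (n i) (n i) ℂ) :
    LinearMap.ker (sylvester (Matrix.blockDiagonal' B) (Matrix.blockDiagonal' C)) ≃ₗ[ℂ]
      (∀ i j, LinearMap.ker (sylvester (B i) (C j))) where
  toFun X i j := ⟨Matrix.of fun s t => X.1 ⟨i, s⟩ ⟨j, t⟩,
    mem_ker_sylvester_blockDiagonal'.1 X.2 i j⟩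
  map_add' _ _ := rfl
  map_smul' _ _ := rfl
  invFun Y := ⟨Matrix.of fun x y => (Y x.1 y.1).1 x.2 y.2,
    mem_ker_sylvester_blockDiagonal'.2 fun i j => (Y i j).2⟩
  left_inv _ := rfl
  right_inv _ := rfl

theorem finrank_ker_sylvester_jordan (r : ι → ℕ) (z : ι → ℂ) (q : κ → ℕ) (w : κ → ℂ) :
    Module.finrank ℂ (LinearMap.ker (sylvester
      (Matrix.blockDiagonal' fun i => jordanBlock (r i) (z i))
      (Matrix.blockDiagonal' fun i => jordanBlock (q i) (w i)))) =
      ∑ i, ∑ j, if z i = w j then min (r i) (q j) else 0 := by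
  rw [(kerSylvesterBlockDiagonalEquiv _ _).finrank_eq, Module.finrank_pi_fintype]
  refine Finset.sum_congr rfl fun i _ => ?_
  rw [Module.finrank_pi_fintype]
  exact Finset.sum_congr rfl fun j _ => finrank_ker_sylvester_jordanBlock _ _

end JordanBlocks
-- Semicontinuity of the intertwiner dimension.
section Semicontinuity

open Topology Filter

/-- The bound is joint in the matrix and in `z`, because the eigenvalue at which a nearby matrix is
tested moves with it. -/
theorem eventually_finrank_ker_sylvester_le {n : ℕ} (A : Matrix (Fin n) (Fin n) ℂ) (z : ℂ)
    (i : ℕ) : ∀ᶠ x in 𝓝 A ×ˢ 𝓝 z,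
      Module.finrank ℂ (LinearMap.ker (sylvester x.1 (jordanBlock i x.2))) ≤
        Module.finrank ℂ (LinearMap.ker (sylvester A (jordanBlock i z))) := by
  rw [← nhds_prod_eq]
  let _ : NormedAddCommGroup (Matrix (Fin n) (Fin i) ℂ) := Matrix.normedAddCommGroup
  let _ : NormedSpace ℂ (Matrix (Fin n) (Fin i) ℂ) := Matrix.normedSpace
  have hJ : Continuous fun w : ℂ => jordanBlock i w := by
    refine continuous_matrix fun s t => ?_
    simp only [jordanBlock, Matrix.of_apply]
    split_ifs <;> fun_prop
  refine eventually_finrank_ker_le (X := Matrix (Fin n) (Fin n) ℂ × ℂ)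
    (fun x => LinearMap.toContinuousLinearMap (sylvester x.1 (jordanBlock i x.2))) ?_ (A, z)
  rw [continuous_clm_apply]
  intro X
  have h2 : Continuous fun x : Matrix (Fin n) (Fin n) ℂ × ℂ =>
      x.1 * X - X * jordanBlock i x.2 :=
    (continuous_fst.matrix_mul continuous_const).sub
      (continuous_const.matrix_mul (hJ.comp continuous_snd))
  exact h2

end Semicontinuity

/-! ### Recovering a partition from its truncated sums. -/

section Partitions

/-- Raising `i` by one increases `∑ min (u j) i` by the number of `j` with `u j > i`. If `u j₀ < v
j₀`, then at `i = u j₀` this number is at most `j₀` for `u` and at least `j₀ + 1` for `v`. -/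
theorem le_of_sum_min_eq {u v : ℕ → ℕ} (hu : Antitone u) (hv : Antitone v) {M n : ℕ}
    (hvM : ∀ j, M ≤ j → v j = 0) (hvn : ∀ j, v j ≤ n)
    (h : ∀ i ≤ n, ∑ j ∈ Finset.range M, min (u j) i = ∑ j ∈ Finset.range M, min (v j) i)
    (j₀ : ℕ) : v j₀ ≤ u j₀ := by
  by_contra! hlt
  have hj : j₀ < M := by
    by_contra! hM
    have := hvM j₀ hM
    omega
  have hn := hvn j₀
  have h1 : ∑ j ∈ Finset.range M, min (u j) (u j₀ + 1) ≤
      ∑ j ∈ Finset.range M, (min (u j) (u j₀) + if j ∈ Finset.range j₀ then 1 else 0) := by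
    refine Finset.sum_le_sum fun j _ => ?_
    split_ifs with hjj
    · omega
    · have := hu (not_lt.1 (fun h => hjj (Finset.mem_range.2 h)))
      omega
  have h2 : ∑ j ∈ Finset.range M, (min (v j) (u j₀) +
      if j ∈ Finset.range (j₀ + 1) then 1 else 0) ≤
      ∑ j ∈ Finset.range M, min (v j) (u j₀ + 1) := by
    refine Finset.sum_le_sum fun j _ => ?_
    split_ifs with hjj
    · have := hv (Nat.lt_succ_iff.1 (Finset.mem_range.1 hjj))
      omega
    · omega
  rw [Finset.sum_add_distrib, ← Finset.sum_filter, Finset.filter_mem_eq_inter,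
    Finset.inter_eq_right.2 (Finset.range_subset_range.2 (by omega))] at h1 h2
  simp only [Finset.sum_const, Finset.card_range, smul_eq_mul, mul_one] at h1 h2
  have h3 := h (u j₀) (by omega)
  have h4 := h (u j₀ + 1) (by omega)
  omega

end Partitions

/-! ### Jordan matrices: eigenvalue shifts, relabelling, characteristic determinant. -/

section JordanMatrix

variable {p : ℕ} {N : Fin p → ℕ} {k : Fin p → ℕ → ℕ}

theorem jordanIndex_ext_iff {x y : JordanIndex N k} :
    x = y ↔ x.1 = y.1 ∧ (x.2 : ℕ) = y.2 := by
  constructor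
  · rintro rfl; exact ⟨rfl, rfl⟩
  · obtain ⟨b, s⟩ := x
    obtain ⟨c, t⟩ := y
    rintro ⟨h1, h2⟩
    simp only at h1
    subst h1
    obtain rfl : s = t := Fin.ext h2
    rfl

theorem blockIndex_ext_iff {x y : Σ a : Fin p, Fin (N a)} :
    x = y ↔ x.1 = y.1 ∧ (x.2 : ℕ) = y.2 := by
  constructor
  · rintro rfl; exact ⟨rfl, rfl⟩
  · obtain ⟨b, s⟩ := x
    obtain ⟨c, t⟩ := y
    rintro ⟨h1, h2⟩
    simp only at h1
    subst h1
    obtain rfl : s = t := Fin.ext h2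
    rfl

theorem jordanMatrix_apply (ev : Fin p → ℂ) (x y : JordanIndex N k) :
    jordanMatrix N k ev x y = if x = y then ev x.1.1 else
      if x.1 = y.1 ∧ (x.2 : ℕ) + 1 = y.2 then 1 else 0 := by
  obtain ⟨b, s⟩ := x
  obtain ⟨c, t⟩ := y
  by_cases h : b = c
  · subst h
    rw [jordanMatrix, Matrix.blockDiagonal'_apply_eq]
    simp only [jordanBlock, Matrix.of_apply, jordanIndex_ext_iff, Fin.ext_iff, true_and]
  · rw [jordanMatrix, Matrix.blockDiagonal'_apply_ne _ _ _ h]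
    simp [h]

theorem jordanMatrix_add (ev δ : Fin p → ℂ) :
    jordanMatrix N k (ev + δ) = jordanMatrix N k ev + Matrix.diagonal fun x => δ x.1.1 := by
  ext x y
  rw [Matrix.add_apply, jordanMatrix_apply, jordanMatrix_apply, Matrix.diagonal_apply]
  split_ifs <;> simp

theorem diagonal_mul_jordanMatrix (ev δ : Fin p → ℂ) :
    (Matrix.diagonal fun x : JordanIndex N k => δ x.1.1) * jordanMatrix N k ev =
      jordanMatrix N k ev * Matrix.diagonal fun x => δ x.1.1 := by
  ext x y
  rw [Matrix.diagonal_mul, Matrix.mul_diagonal, jordanMatrix_apply]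
  split_ifs with h1 h2
  · rw [h1, mul_comm]
  · rw [h2.1, mul_comm]
  · simp

/-- Eigenvalues with the same block orders can be exchanged by permuting the basis vectors. -/
theorem rectSimilar_jordanMatrix_comp {g : Fin p → Fin p} (hg : Function.Injective g)
    (hN : ∀ a, N (g a) = N a) (hk : ∀ a j, k (g a) (j + 1) = k a (j + 1)) (ev : Fin p → ℂ) :
    RectSimilar (jordanMatrix N k (ev ∘ g)) (jordanMatrix N k ev) := by
  let ψ : (Σ a : Fin p, Fin (N a)) → Σ a : Fin p, Fin (N a) :=
    fun b => ⟨g b.1, Fin.cast (hN b.1).symm b.2⟩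
  have hψ : ∀ b c, ψ b = ψ c ↔ b = c := fun b c => by
    rw [blockIndex_ext_iff, blockIndex_ext_iff]
    simp [ψ, hg.eq_iff]
  let E : JordanIndex N k → JordanIndex N k :=
    fun x => ⟨ψ x.1, Fin.cast (hk x.1.1 x.1.2).symm x.2⟩
  have hE : ∀ x y, E x = E y ↔ x = y := fun x y => by
    rw [jordanIndex_ext_iff, jordanIndex_ext_iff]
    simp [E, hψ]
  have hEb : Function.Bijective E :=
    Finite.injective_iff_bijective.1 fun x y h => (hE x y).1 h
  convert! RectSimilar.submatrix (jordanMatrix N k ev) (Equiv.ofBijective E hEb) using 1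
  ext x y
  rw [Matrix.submatrix_apply, jordanMatrix_apply, jordanMatrix_apply]
  simp only [Equiv.ofBijective_apply, hE]
  have h1 : (E x).1 = (E y).1 ↔ x.1 = y.1 := hψ _ _
  simp only [h1]
  rfl

theorem mem_jordanSet_iff {n : ℕ} {A : Matrix (Fin n) (Fin n) ℂ} :
    A ∈ jordanSet n N k ↔
      ∃ ev : Fin p → ℂ, Function.Injective ev ∧ RectSimilar A (jordanMatrix N k ev) := by
  constructor
  · rintro ⟨ev, e, T, hev, rfl⟩
    exact ⟨ev, hev, (RectSimilar.conj _ T).trans (RectSimilar.submatrix _ e)⟩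
  · rintro ⟨ev, hev, U, V, h1, h2, h3⟩
    have hcard : Fintype.card (Fin n) = Fintype.card (JordanIndex N k) :=
      Matrix.square_of_invertible U V h1 h2
    let e : Fin n ≃ JordanIndex N k := Fintype.equivOfCardEq hcard
    have i1 : U.submatrix id e * V.submatrix e id = 1 := by
      rw [← Matrix.submatrix_mul _ _ _ _ _ e.bijective, h1, Matrix.submatrix_id_id]
    have i2 : V.submatrix e id * U.submatrix id e = 1 := by
      rw [← Matrix.submatrix_mul _ _ _ _ _ Function.bijective_id, h2, Matrix.submatrix_one_equiv]
    refine ⟨ev, e, ⟨U.submatrix id e, V.submatrix e id, i1, i2⟩, hev, ?_⟩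
    change A = U.submatrix id e * (jordanMatrix N k ev).submatrix e e * V.submatrix e id
    rw [← Matrix.submatrix_mul _ _ _ _ _ e.bijective, ← h3,
      ← Matrix.submatrix_mul _ _ _ _ _ e.bijective, Matrix.mul_assoc, h1, Matrix.mul_one,
      Matrix.submatrix_id_id]

theorem det_blockDiagonal_sigma {R ι : Type*} [CommRing R] [Fintype ι] [DecidableEq ι]
    {m : ι → Type*} [∀ i, Fintype (m i)] [∀ i, DecidableEq (m i)]
    (B : ∀ i, Matrix (m i) (m i) R) : (Matrix.blockDiagonal' B).det = ∏ i, (B i).det := by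
  let e := Fintype.equivFin ι
  have h : (Matrix.blockDiagonal' B).BlockTriangular fun x => e x.1 := by
    rintro ⟨i, s⟩ ⟨j, t⟩ hij
    refine Matrix.blockDiagonal'_apply_ne _ _ _ ?_
    rintro rfl
    exact lt_irrefl _ hij
  rw [h.det_fintype, ← Equiv.prod_comp e]
  refine Finset.prod_congr rfl fun i _ => ?_
  let f : m i ≃ {x : Σ i, m i // e x.1 = e i} :=
    { toFun := fun s => ⟨⟨i, s⟩, rfl⟩
      invFun := fun x => (e.injective x.2) ▸ x.1.2
      left_inv := fun s => rfl
      right_inv := by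
        rintro ⟨⟨j, s⟩, hj⟩
        obtain rfl := e.injective hj
        rfl }
  rw [← Matrix.det_submatrix_equiv_self f]
  congr 1
  ext s t
  simp [f, Matrix.toSquareBlock_def, Matrix.blockDiagonal'_apply_eq]

theorem det_scalar_sub_jordanBlock (r : ℕ) (z w : ℂ) :
    (Matrix.scalar (Fin r) z - jordanBlock r w).det = (z - w) ^ r := by
  rw [Matrix.det_of_isUpperTriangular]
  · simp [jordanBlock]
  · intro s t hst
    have h1 : s ≠ t := ne_of_gt hst
    have h2 : ¬ (s : ℕ) + 1 = t := by
      have : (t : ℕ) < s := hst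
      omega
    simp [jordanBlock, h1, h2]

theorem det_scalar_sub_jordanMatrix (ev : Fin p → ℂ) (z : ℂ) :
    (Matrix.scalar (JordanIndex N k) z - jordanMatrix N k ev).det =
      ∏ x : JordanIndex N k, (z - ev x.1.1) := by
  have h : Matrix.scalar (JordanIndex N k) z - jordanMatrix N k ev =
      Matrix.blockDiagonal' fun b : (Σ a : Fin p, Fin (N a)) =>
        Matrix.scalar (Fin (k b.1 ((b.2 : ℕ) + 1))) z -
          jordanBlock (k b.1 ((b.2 : ℕ) + 1)) (ev b.1) := by
    rw [jordanMatrix]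
    ext ⟨b, s⟩ ⟨c, t⟩
    by_cases hbc : b = c
    · subst hbc
      simp [Matrix.blockDiagonal'_apply_eq, Matrix.diagonal_apply]
    · simp [Matrix.blockDiagonal'_apply_ne _ _ _ hbc, hbc]
  rw [h, det_blockDiagonal_sigma,
    Fintype.prod_sigma (fun x : JordanIndex N k => z - ev x.1.1)]
  exact Finset.prod_congr rfl fun b _ => by rw [det_scalar_sub_jordanBlock]; simp

theorem RectSimilar.det_scalar_sub {m m' : Type*} [Fintype m] [Fintype m'] [DecidableEq m]
    [DecidableEq m'] {A : Matrix m m ℂ} {J : Matrix m' m' ℂ} (h : RectSimilar A J) (z : ℂ) :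
    (Matrix.scalar m z - A).det = (Matrix.scalar m' z - J).det := by
  obtain ⟨U, V, h1, h2, h3⟩ := h
  rw [← Matrix.det_conj_of_mul_eq_one h1 h2 (N := Matrix.scalar m' z - J)]
  congr 1
  rw [Matrix.mul_sub, ← h3, Matrix.sub_mul, Matrix.mul_assoc A, h1, Matrix.mul_one]
  simp only [Matrix.scalar_apply, ← Matrix.smul_one_eq_diagonal, Matrix.mul_smul, Matrix.mul_one,
    Matrix.smul_mul, h1]

end JordanMatrix
-- Transversality of eigenvalue shifts, and nearby matrices of the same Jordan type.
section JordanManifold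

open Topology Filter ComplexOrder

variable {n p : ℕ} {N : Fin p → ℕ} {k : Fin p → ℕ → ℕ}

theorem exists_jordanIndex (hN : ∀ a, 1 ≤ N a)
    (hpos : ∀ a, ∀ j ∈ Finset.Icc 1 (N a), 1 ≤ k a j) (a : Fin p) :
    ∃ x : JordanIndex N k, x.1.1 = a :=
  ⟨⟨⟨a, ⟨0, hN a⟩⟩, ⟨0, hpos a 1 (Finset.mem_Icc.2 ⟨le_rfl, hN a⟩)⟩⟩, rfl⟩

/-- The matrices obtained from a Jordan basis by prescribing a scalar on each generalized
eigenspace. -/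
def eigenShift (U : Matrix (Fin n) (JordanIndex N k) ℂ) (V : Matrix (JordanIndex N k) (Fin n) ℂ) :
    (Fin p → ℂ) →ₗ[ℂ] Matrix (Fin n) (Fin n) ℂ where
  toFun δ := U * Matrix.diagonal (fun x : JordanIndex N k => δ x.1.1) * V
  map_add' δ δ' := by
    rw [← Matrix.add_mul, ← Matrix.mul_add, Matrix.diagonal_add]
    rfl
  map_smul' c δ := by
    rw [RingHom.id_apply, ← Matrix.smul_mul, ← Matrix.mul_smul, ← Matrix.diagonal_smul]
    rfl

theorem eigenShift_apply (U : Matrix (Fin n) (JordanIndex N k) ℂ)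
    (V : Matrix (JordanIndex N k) (Fin n) ℂ) (δ : Fin p → ℂ) :
    eigenShift U V δ = U * Matrix.diagonal (fun x : JordanIndex N k => δ x.1.1) * V := rfl

variable {U : Matrix (Fin n) (JordanIndex N k) ℂ} {V : Matrix (JordanIndex N k) (Fin n) ℂ}
  {A : Matrix (Fin n) (Fin n) ℂ} {ev : Fin p → ℂ}

theorem rectSimilar_add_eigenShift (h1 : U * V = 1) (h2 : V * U = 1)
    (h3 : A * U = U * jordanMatrix N k ev) (δ : Fin p → ℂ) :
    RectSimilar (A + eigenShift U V δ) (jordanMatrix N k (ev + δ)) := by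
  refine ⟨U, V, h1, h2, ?_⟩
  rw [jordanMatrix_add, Matrix.add_mul, Matrix.mul_add, h3, eigenShift_apply, Matrix.mul_assoc,
    h2, Matrix.mul_one]

theorem eigenShift_injective (h2 : V * U = 1) (hx : ∀ a, ∃ x : JordanIndex N k, x.1.1 = a) :
    Function.Injective (eigenShift U V) := by
  have key : ∀ δ, V * eigenShift U V δ * U = Matrix.diagonal fun x => δ x.1.1 := fun δ => by
    rw [eigenShift_apply, ← Matrix.mul_assoc, ← Matrix.mul_assoc, h2, Matrix.one_mul,
      Matrix.mul_assoc, h2, Matrix.mul_one]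
  intro δ δ' h
  ext a
  obtain ⟨x, rfl⟩ := hx a
  have := key δ
  rw [h, key δ'] at this
  exact (congrFun (Matrix.diagonal_injective this) x).symm

theorem eigenShift_commute (h1 : U * V = 1) (h2 : V * U = 1)
    (h3 : A * U = U * jordanMatrix N k ev) (δ : Fin p → ℂ) :
    eigenShift U V δ * A = A * eigenShift U V δ := by
  have hA : V * A = jordanMatrix N k ev * V := by
    calc V * A = V * (A * U) * V := by rw [Matrix.mul_assoc, Matrix.mul_assoc, h1, Matrix.mul_one]
      _ = _ := by rw [h3, ← Matrix.mul_assoc, h2, Matrix.one_mul]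
  rw [eigenShift_apply, Matrix.mul_assoc, hA, ← Matrix.mul_assoc, Matrix.mul_assoc U,
    diagonal_mul_jordanMatrix, ← Matrix.mul_assoc, ← h3]
  simp only [Matrix.mul_assoc]

/-- A matrix that commutes with `A` has zero trace pairing with every commutator `A t - t A`.
Pairing with the shift by the conjugate of `δ` yields `∑ |δ|² = 0` over all rows, and every
eigenvalue occurs in some row. -/
theorem eq_zero_of_eigenShift_eq_commutator (h1 : U * V = 1) (h2 : V * U = 1)
    (h3 : A * U = U * jordanMatrix N k ev) (hx : ∀ a, ∃ x : JordanIndex N k, x.1.1 = a)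
    {δ : Fin p → ℂ} {t : Matrix (Fin n) (Fin n) ℂ} (h : A * t - t * A = eigenShift U V δ) :
    δ = 0 := by
  have hprod : ∀ δ', eigenShift U V δ' * eigenShift U V δ =
      U * Matrix.diagonal (fun x : JordanIndex N k => δ' x.1.1 * δ x.1.1) * V := fun δ' => by
    rw [eigenShift_apply, eigenShift_apply, ← Matrix.mul_assoc, ← Matrix.mul_assoc,
      Matrix.mul_assoc _ V U, h2, Matrix.mul_one, Matrix.mul_assoc U, Matrix.diagonal_mul_diagonal]
  have htr : ∀ δ' : Fin p → ℂ, ∑ x : JordanIndex N k, δ' x.1.1 * δ x.1.1 = 0 := fun δ' => by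
    have e1 : (eigenShift U V δ' * eigenShift U V δ).trace =
        ∑ x : JordanIndex N k, δ' x.1.1 * δ x.1.1 := by
      rw [hprod, Matrix.trace_mul_comm, ← Matrix.mul_assoc, h2, Matrix.one_mul,
        Matrix.trace_diagonal]
    rw [← e1, ← h, Matrix.mul_sub, Matrix.trace_sub, ← Matrix.mul_assoc,
      eigenShift_commute h1 h2 h3, Matrix.mul_assoc, Matrix.trace_mul_comm, Matrix.mul_assoc,
      sub_self]
  ext a
  obtain ⟨x, rfl⟩ := hx a
  have hs := htr (star δ)
  have hs' : (fun x : JordanIndex N k => δ x.1.1) = 0 := by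
    rw [← dotProduct_star_self_eq_zero]
    exact hs
  exact congrFun hs' x

/-- The dimension of the centralizer of a Jordan matrix with distinct eigenvalues. -/
def centralizerDim (N : Fin p → ℕ) (k : Fin p → ℕ → ℕ) : ℕ :=
  ∑ b : (Σ a : Fin p, Fin (N a)), ∑ c : (Σ a : Fin p, Fin (N a)),
    if b.1 = c.1 then min (k b.1 ((b.2 : ℕ) + 1)) (k c.1 ((c.2 : ℕ) + 1)) else 0

/-- The value does not depend on `ev`; this provides the constant dimension required by
`exists_straightening`. -/
theorem finrank_ker_sylvester_jordanMatrix (hev : Function.Injective ev)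
    {B C : Matrix (Fin n) (Fin n) ℂ} (hB : RectSimilar B (jordanMatrix N k ev))
    (hC : RectSimilar C (jordanMatrix N k ev)) :
    Module.finrank ℂ (LinearMap.ker (sylvester B C)) = centralizerDim N k := by
  rw [hB.finrank_ker_sylvester_eq hC, jordanMatrix, finrank_ker_sylvester_jordan, centralizerDim]
  simp only [hev.eq_iff]

/-- Testing against Jordan blocks of all orders `i` reads off the truncated sums of the partition
attached to one eigenvalue. -/
theorem finrank_ker_sylvester_jordanBlock_eq_sum (hev : Function.Injective ev)
    {B : Matrix (Fin n) (Fin n) ℂ} (hB : RectSimilar B (jordanMatrix N k ev)) (a : Fin p)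
    (i : ℕ) :
    Module.finrank ℂ (LinearMap.ker (sylvester B (jordanBlock i (ev a)))) =
      ∑ j ∈ Finset.range (N a), min (k a (j + 1)) i := by
  have hC : RectSimilar (jordanBlock i (ev a))
      (Matrix.blockDiagonal' fun _ : Unit => jordanBlock i (ev a)) := by
    let e : Fin i ≃ Σ _ : Unit, Fin i := (Equiv.uniqueSigma fun _ : Unit => Fin i).symm
    convert! RectSimilar.submatrix
      (Matrix.blockDiagonal' fun _ : Unit => jordanBlock i (ev a)) e using 1
  rw [hB.finrank_ker_sylvester_eq hC, jordanMatrix, finrank_ker_sylvester_jordan]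
  simp only [Finset.univ_unique, Finset.sum_singleton, hev.eq_iff]
  rw [Fintype.sum_sigma, Finset.sum_eq_single a]
  · simp [Finset.sum_range]
  · intro b _ hb
    simp [hb]
  · simp

/-- If all eigenvalues of `B` had distance at least `ε` from `ev a`, then `|det (ev a - B)|` would
be at least a fixed power of `ε`; but this determinant is continuous and vanishes at `A`. -/
theorem eventually_exists_eigenvalue_near (hA : RectSimilar A (jordanMatrix N k ev))
    (hx : ∀ a, ∃ x : JordanIndex N k, x.1.1 = a) (a : Fin p) {ε : ℝ} (hε : 0 < ε) :
    ∀ᶠ B in 𝓝 A, ∀ μ : Fin p → ℂ, RectSimilar B (jordanMatrix N k μ) →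
      ∃ b, ‖μ b - ev a‖ < ε := by
  have hcont : Continuous fun B : Matrix (Fin n) (Fin n) ℂ =>
      ‖(Matrix.scalar (Fin n) (ev a) - B).det‖ :=
    ((continuous_const.sub continuous_id).matrix_det).norm
  have h0 : ‖(Matrix.scalar (Fin n) (ev a) - A).det‖ = 0 := by
    obtain ⟨x, hx⟩ := hx a
    rw [norm_eq_zero, hA.det_scalar_sub, det_scalar_sub_jordanMatrix]
    exact Finset.prod_eq_zero (Finset.mem_univ x) (by rw [hx, sub_self])
  have hlt : ∀ᶠ B in 𝓝 A, ‖(Matrix.scalar (Fin n) (ev a) - B).det‖ <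
      ε ^ Fintype.card (JordanIndex N k) :=
    hcont.continuousAt.eventually_lt continuousAt_const (by rw [h0]; positivity)
  filter_upwards [hlt] with B hB μ hμ
  by_contra! hcon
  refine absurd hB (not_lt.2 ?_)
  rw [hμ.det_scalar_sub, det_scalar_sub_jordanMatrix, norm_prod, ← Finset.card_univ,
    ← Finset.prod_const]
  refine Finset.prod_le_prod (fun _ _ => hε.le) fun x _ => ?_
  rw [norm_sub_rev]
  exact hcon _

theorem antitone_shift (hanti : ∀ a, AntitoneOn (k a) (Set.Icc 1 (N a)))
    (hzero : ∀ a j, N a < j → k a j = 0) (a : Fin p) : Antitone fun j => k a (j + 1) := by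
  intro i j hij
  by_cases hj : j + 1 ≤ N a
  · exact hanti a ⟨by omega, by omega⟩ ⟨by omega, hj⟩ (by omega)
  · simp only [hzero a (j + 1) (by omega)]
    exact Nat.zero_le _

theorem sum_range_min_extend (hzero : ∀ a j, N a < j → k a j = 0) (a : Fin p) {M : ℕ}
    (hM : N a ≤ M) (i : ℕ) : ∑ j ∈ Finset.range (N a), min (k a (j + 1)) i =
      ∑ j ∈ Finset.range M, min (k a (j + 1)) i := by
  refine Finset.sum_subset (Finset.range_subset_range.2 hM) fun j _ hj => ?_
  rw [hzero a (j + 1) (by simpa [Nat.lt_succ_iff] using hj)]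
  simp

theorem blockOrder_le_of_sum_min_eq (hanti : ∀ a, AntitoneOn (k a) (Set.Icc 1 (N a)))
    (hzero : ∀ a j, N a < j → k a j = 0) {m : ℕ} (hm : ∀ a j, k a (j + 1) ≤ m) {a b : Fin p}
    (h : ∀ i ≤ m, ∑ j ∈ Finset.range (N a), min (k a (j + 1)) i =
      ∑ j ∈ Finset.range (N b), min (k b (j + 1)) i) (j : ℕ) : k b (j + 1) ≤ k a (j + 1) := by
  refine le_of_sum_min_eq (u := fun j => k a (j + 1)) (v := fun j => k b (j + 1))
    (antitone_shift hanti hzero a)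
    (antitone_shift hanti hzero b) (M := max (N a) (N b)) (n := m) (fun j hj => ?_)
    (hm b) (fun i hi => ?_) j
  · exact hzero b _ (by omega)
  · rw [← sum_range_min_extend hzero a (le_max_left _ _),
      ← sum_range_min_extend hzero b (le_max_right _ _), h i hi]

theorem blockCount_le (hpos : ∀ a, ∀ j ∈ Finset.Icc 1 (N a), 1 ≤ k a j)
    (hN : ∀ a, 1 ≤ N a)
    (hzero : ∀ a j, N a < j → k a j = 0) {a b : Fin p}
    (h : ∀ j, k b (j + 1) ≤ k a (j + 1)) : N b ≤ N a := by
  by_contra! hlt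
  have h1 := hpos b (N b) (Finset.mem_Icc.2 ⟨hN b, le_rfl⟩)
  have h2 := hzero a (N b) hlt
  have h3 := h (N b - 1)
  rw [Nat.sub_add_cancel (hN b)] at h3
  omega

/-- A matrix of the given Jordan type close to `A` is similar to `A` with slightly shifted
eigenvalues. -/
theorem eventually_exists_shift
    (hN : ∀ a, 1 ≤ N a)
    (hpos : ∀ a, ∀ j ∈ Finset.Icc 1 (N a), 1 ≤ k a j)
    (hanti : ∀ a, AntitoneOn (k a) (Set.Icc 1 (N a)))
    (hzero : ∀ a j, N a < j → k a j = 0)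
    (hev : Function.Injective ev) (hA : RectSimilar A (jordanMatrix N k ev))
    {W : Set (Fin p → ℂ)} (hW : W ∈ 𝓝 0) :
    ∀ᶠ B in 𝓝 A, B ∈ jordanSet n N k → ∃ δ ∈ W, Function.Injective (ev + δ) ∧
      RectSimilar B (jordanMatrix N k (ev + δ)) := by
  have hx := exists_jordanIndex hN hpos
  obtain ⟨m, hm⟩ : ∃ m, ∀ a j, k a (j + 1) ≤ m := by
    refine ⟨∑ a, k a 1, fun a j => ?_⟩
    refine (antitone_shift hanti hzero a (Nat.zero_le j)).trans ?_
    exact Finset.single_le_sum (f := fun a => k a 1) (fun _ _ => Nat.zero_le _)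
      (Finset.mem_univ a)
  have hsc : ∀ a, ∀ᶠ x in 𝓝 A ×ˢ 𝓝 (ev a), ∀ i ∈ Finset.range (m + 1),
      Module.finrank ℂ (LinearMap.ker (sylvester x.1 (jordanBlock i x.2))) ≤
        Module.finrank ℂ (LinearMap.ker (sylvester A (jordanBlock i (ev a)))) := fun a =>
    (Filter.eventually_all_finset _).2 fun i _ => eventually_finrank_ker_sylvester_le A (ev a) i
  simp only [eventually_prod_iff] at hsc
  choose PA hPA Pz hPz hP using hsc
  obtain ⟨ε, hε, hεW, hεz, hεs⟩ : ∃ ε > 0, Metric.ball (0 : Fin p → ℂ) ε ⊆ W ∧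
      (∀ a, Metric.ball (ev a) ε ⊆ {z | Pz a z}) ∧
      (∀ a b, a ≠ b → Disjoint (Metric.ball (ev a) ε) (Metric.ball (ev b) ε)) := by
    have h1 : ∀ᶠ ε in 𝓝[>] (0 : ℝ), Metric.ball (0 : Fin p → ℂ) ε ⊆ W := by
      obtain ⟨r, hr, hrW⟩ := Metric.mem_nhds_iff.1 hW
      filter_upwards [Ioo_mem_nhdsGT hr] with ε hε
      exact (Metric.ball_subset_ball hε.2.le).trans hrW
    have h2 : ∀ᶠ ε in 𝓝[>] (0 : ℝ), ∀ a, Metric.ball (ev a) ε ⊆ {z | Pz a z} := by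
      refine eventually_all.2 fun a => ?_
      obtain ⟨r, hr, hrW⟩ := Metric.mem_nhds_iff.1 (hPz a)
      filter_upwards [Ioo_mem_nhdsGT hr] with ε hε
      exact (Metric.ball_subset_ball hε.2.le).trans hrW
    have h3 : ∀ᶠ ε in 𝓝[>] (0 : ℝ), ∀ a b, a ≠ b →
        Disjoint (Metric.ball (ev a) ε) (Metric.ball (ev b) ε) := by
      refine eventually_all.2 fun a => eventually_all.2 fun b => ?_
      by_cases hab : a = b
      · exact Eventually.of_forall fun _ h => absurd hab h
      · have hd : 0 < dist (ev a) (ev b) / 2 := half_pos (dist_pos.2 (hev.ne hab))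
        filter_upwards [Ioo_mem_nhdsGT hd] with ε hε _
        exact Metric.ball_disjoint_ball (by linarith [hε.2])
    obtain ⟨ε, h, hε⟩ := ((h1.and (h2.and h3)).and self_mem_nhdsWithin).exists
    exact ⟨ε, hε, h⟩
  filter_upwards [eventually_all.2 hPA,
    eventually_all.2 fun a => eventually_exists_eigenvalue_near hA hx a hε] with B hB hnear hBS
  obtain ⟨μ, hμ, hBμ⟩ := mem_jordanSet_iff.1 hBS
  choose g hg using fun a => hnear a μ hBμ
  have hball : ∀ a, μ (g a) ∈ Metric.ball (ev a) ε := fun a => mem_ball_iff_norm.2 (hg a)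
  -- The balls around the eigenvalues of `A` are disjoint and there are `p` eigenvalues on both
  -- sides, so `g` is a permutation.
  have hginj : Function.Injective g := by
    intro a b hab
    by_contra hne
    exact Set.disjoint_left.1 (hεs a b hne) (hball a) (hab ▸ hball b)
  have hgbij : Function.Bijective g := Finite.injective_iff_bijective.1 hginj
  have hle : ∀ i ≤ m, ∀ a, ∑ j ∈ Finset.range (N (g a)), min (k (g a) (j + 1)) i ≤
      ∑ j ∈ Finset.range (N a), min (k a (j + 1)) i := by
    intro i hi a
    have := hP a (hB a) (hεz a (hball a)) i (Finset.mem_range.2 (by omega))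
    rwa [finrank_ker_sylvester_jordanBlock_eq_sum hμ hBμ,
      finrank_ker_sylvester_jordanBlock_eq_sum hev hA] at this
  have heq : ∀ i ≤ m, ∀ a, ∑ j ∈ Finset.range (N (g a)), min (k (g a) (j + 1)) i =
      ∑ j ∈ Finset.range (N a), min (k a (j + 1)) i := by
    intro i hi a
    -- Both sides have the same total over `a`, as `g` only permutes the terms; hence none of the
    -- inequalities is strict.
    refine (Finset.sum_eq_sum_iff_of_le fun a _ => hle i hi a).1 ?_ a (Finset.mem_univ a)
    exact hgbij.sum_comp fun a => ∑ j ∈ Finset.range (N a), min (k a (j + 1)) i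
  have hk : ∀ a j, k (g a) (j + 1) = k a (j + 1) := fun a j => le_antisymm
    (blockOrder_le_of_sum_min_eq hanti hzero hm (fun i hi => (heq i hi a).symm) j)
    (blockOrder_le_of_sum_min_eq hanti hzero hm (fun i hi => heq i hi a) j)
  have hNg : ∀ a, N (g a) = N a := fun a => le_antisymm
    (blockCount_le hpos hN hzero fun j => (hk a j).le)
    (blockCount_le hpos hN hzero fun j => (hk a j).ge)
  have hadd : ev + (μ ∘ g - ev) = μ ∘ g := by abel
  refine ⟨μ ∘ g - ev, hεW ?_, ?_, ?_⟩
  · rw [mem_ball_zero_iff, pi_norm_lt_iff hε]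
    exact hg
  · rw [hadd]
    exact hμ.comp hginj
  · rw [hadd]
    exact hBμ.trans (rectSimilar_jordanMatrix_comp hginj hNg hk μ).symm

end JordanManifold

/-! ### The chart for the matrices of a given Jordan type, and its dimension. -/

section Dimension

open Topology Filter

attribute [local instance] Matrix.linftyOpNormedRing Matrix.linftyOpNormedAlgebra

variable {n p : ℕ} {N : Fin p → ℕ} {k : Fin p → ℕ → ℕ}

theorem intertwine_eq_sylvester (B C : Matrix (Fin n) (Fin n) ℂ) :
    (intertwine B C : Matrix (Fin n) (Fin n) ℂ →ₗ[ℂ] Matrix (Fin n) (Fin n) ℂ) =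
      sylvester B C := rfl

theorem exists_straightening_jordanSet
    (hN : ∀ a, 1 ≤ N a)
    (hpos : ∀ a, ∀ j ∈ Finset.Icc 1 (N a), 1 ≤ k a j)
    (hanti : ∀ a, AntitoneOn (k a) (Set.Icc 1 (N a)))
    (hzero : ∀ a j, N a < j → k a j = 0)
    {A : Matrix (Fin n) (Fin n) ℂ} (hA : A ∈ jordanSet n N k) :
    ∃ (φ : OpenPartialHomeomorph (Matrix (Fin n) (Fin n) ℂ) (Matrix (Fin n) (Fin n) ℂ))
      (W : Submodule ℂ (Matrix (Fin n) (Fin n) ℂ)),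
      A ∈ φ.source ∧ DifferentiableOn ℂ φ φ.source ∧ DifferentiableOn ℂ φ.symm φ.target ∧
      Module.finrank ℂ W + centralizerDim N k = n ^ 2 + p ∧
      ∀ y ∈ φ.source, y ∈ jordanSet n N k ↔ φ y ∈ W := by
  have hx := exists_jordanIndex hN hpos
  obtain ⟨ev, hev, hsim⟩ := mem_jordanSet_iff.1 hA
  obtain ⟨U, V, h1, h2, h3⟩ := id hsim
  have hQ := eigenShift_injective (n := n) h2 hx
  set P := LinearMap.range (eigenShift U V) with hPdef
  have hdisj : Disjoint (LinearMap.range (intertwine A A : Matrix (Fin n) (Fin n) ℂ →ₗ[ℂ] Matrix (Fin n) (Fin n) ℂ)) P := by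
    rw [Submodule.disjoint_def]
    rintro _ ⟨t, rfl⟩ ⟨δ, hδ⟩
    have hδ0 : δ = 0 := eq_zero_of_eigenShift_eq_commutator h1 h2 h3 hx (t := t) hδ.symm
    rw [← hδ, hδ0, map_zero]
  have hshift : ∀ᶠ δ in 𝓝 (0 : Fin p → ℂ), Function.Injective (ev + δ) := by
    have : ∀ᶠ δ in 𝓝 (0 : Fin p → ℂ), ∀ a b, a ≠ b → (ev + δ) a ≠ (ev + δ) b := by
      refine eventually_all.2 fun a => eventually_all.2 fun b => ?_
      by_cases hab : a = b
      · exact Eventually.of_forall fun _ h => absurd hab h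
      · have hc : ContinuousAt (fun δ : Fin p → ℂ => (ev + δ) a - (ev + δ) b) 0 := by
          simp only [Pi.add_apply]
          fun_prop
        have hne : (ev + 0) a - (ev + 0) b ≠ 0 := by simpa [sub_eq_zero] using hev.ne hab
        filter_upwards [hc.eventually_ne hne] with δ hδ _
        exact sub_ne_zero.1 hδ
    filter_upwards [this] with δ hδ a b hab
    by_contra hne
    exact hδ a b hne hab
  have H1 : ∀ᶠ D in 𝓝 (0 : Matrix (Fin n) (Fin n) ℂ), D ∈ P →
      ∀ u : (Matrix (Fin n) (Fin n) ℂ)ˣ,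
        (u : Matrix (Fin n) (Fin n) ℂ) * (A + D) * (↑u⁻¹ : Matrix (Fin n) (Fin n) ℂ) ∈
          jordanSet n N k := by
    -- A linear left inverse of the shift map is continuous, so a small `D` in `P` comes from a
    -- small `δ`, which keeps the eigenvalues distinct.
    obtain ⟨s, hs⟩ := LinearMap.exists_leftInverse_of_injective _ (LinearMap.ker_eq_bot.2 hQ)
    have hsc : Tendsto s (𝓝 0) (𝓝 0) := by
      simpa using (LinearMap.continuous_of_finiteDimensional s).tendsto 0
    filter_upwards [hsc.eventually hshift] with D hD
    rintro ⟨δ, rfl⟩ u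
    have hsδ : s (eigenShift U V δ) = δ := LinearMap.congr_fun hs δ
    rw [hsδ] at hD
    exact mem_jordanSet_iff.2 ⟨_, hD,
      (RectSimilar.conj _ u).trans (rectSimilar_add_eigenShift h1 h2 h3 δ)⟩
  have H2 : ∀ O ∈ 𝓝 (0 : Matrix (Fin n) (Fin n) ℂ), ∀ᶠ B in 𝓝 A, B ∈ jordanSet n N k →
      ∃ D ∈ P, D ∈ O ∧
      Module.finrank ℂ (LinearMap.ker (intertwine B (A + D) : Matrix (Fin n) (Fin n) ℂ →ₗ[ℂ] Matrix (Fin n) (Fin n) ℂ)) =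
        Module.finrank ℂ (LinearMap.ker (intertwine A A : Matrix (Fin n) (Fin n) ℂ →ₗ[ℂ] Matrix (Fin n) (Fin n) ℂ)) := by
    intro O hO
    have hQc : Tendsto (eigenShift U V) (𝓝 0) (𝓝 0) := by
      simpa using (LinearMap.continuous_of_finiteDimensional (eigenShift U V)).tendsto 0
    have := eventually_exists_shift hN hpos hanti hzero hev hsim (hQc hO)
    refine this.mono fun B hB hBS => ?_
    obtain ⟨δ, hδO, hδ, hBδ⟩ := hB hBS
    refine ⟨_, ⟨δ, rfl⟩, hδO, ?_⟩
    rw [intertwine_eq_sylvester, intertwine_eq_sylvester,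
      finrank_ker_sylvester_jordanMatrix hev hsim hsim]
    exact finrank_ker_sylvester_jordanMatrix hδ hBδ (rectSimilar_add_eigenShift h1 h2 h3 δ)
  obtain ⟨φ, hφ1, hφ2, hφ3, hφ4⟩ := exists_straightening (jordanSet n N k) A P hdisj H1 H2
  refine ⟨φ, _, hφ1, hφ2, hφ3, ?_, hφ4⟩
  have d1 := Submodule.finrank_sup_add_finrank_inf_eq
    (LinearMap.range (intertwine A A : Matrix (Fin n) (Fin n) ℂ →ₗ[ℂ] Matrix (Fin n) (Fin n) ℂ)) P
  rw [hdisj.eq_bot, finrank_bot, add_zero] at d1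
  have d2 := LinearMap.finrank_range_add_finrank_ker (sylvester A A)
  rw [finrank_ker_sylvester_jordanMatrix hev hsim hsim, Module.finrank_matrix] at d2
  have d3 : Module.finrank ℂ P = p := by
    rw [LinearMap.finrank_range_of_inj hQ]
    simp
  rw [intertwine_eq_sylvester] at d1
  simp only [Fintype.card_fin, Module.finrank_self, mul_one] at d2
  rw [intertwine_eq_sylvester, d1, d3, sq, ← d2]
  ring

end Dimension
-- Ideals generated by minors.
section MinorIdeals

variable {R : Type*} [CommRing R] {m m' n n' : Type*}

/-- The ideal generated by the minors of order `r`. -/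
def minorIdeal (M : Matrix m n R) (r : ℕ) : Ideal R :=
  Ideal.span {q | ∃ (f : Fin r ↪ m) (g : Fin r ↪ n), q = (M.submatrix f g).det}

/-- Rows of `P * M` are combinations of rows of `M`. Expanding the determinant multilinearly leaves
minors of `M`, up to the order of the rows, and determinants with a repeated row, which vanish. -/
theorem minorIdeal_mul_le [Fintype m] (P : Matrix m' m R) (M : Matrix m n R) (r : ℕ) :
    minorIdeal (P * M) r ≤ minorIdeal M r := by
  classical
  refine Ideal.span_le.2 ?_
  rintro _ ⟨f, g, rfl⟩
  have h : ((P * M).submatrix f g).det =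
      ∑ h : Fin r → m, (∏ s, P (f s) (h s)) • (M.submatrix h g).det := by
    have e : (P * M).submatrix f g =
        fun s => ∑ i, P (f s) i • (fun t => M i (g t) : Fin r → R) := by
      ext s t
      simp [Matrix.mul_apply, Finset.sum_apply]
    change Matrix.detRowAlternating.toMultilinearMap ((P * M).submatrix f g) = _
    rw [e, MultilinearMap.map_sum]
    exact Finset.sum_congr rfl fun h _ => MultilinearMap.map_smul_univ _ _ _
  rw [h]
  refine Ideal.sum_mem _ fun h _ => Submodule.smul_mem _ _ ?_
  by_cases hinj : Function.Injective h
  · exact Ideal.subset_span ⟨⟨h, hinj⟩, g, rfl⟩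
  · obtain ⟨s, t, hst, hne⟩ : ∃ s t, h s = h t ∧ s ≠ t := by
      simpa [Function.Injective] using hinj
    rw [Matrix.det_zero_of_row_eq hne (by ext; simp [hst])]
    exact Ideal.zero_mem _

theorem minorIdeal_transpose_le (M : Matrix m n R) (r : ℕ) :
    minorIdeal M.transpose r ≤ minorIdeal M r := by
  refine Ideal.span_le.2 ?_
  rintro _ ⟨f, g, rfl⟩
  refine Ideal.subset_span ⟨g, f, ?_⟩
  rw [← Matrix.det_transpose]
  rfl

theorem minorIdeal_mul_le_left [Fintype n] (M : Matrix m n R) (Q : Matrix n n' R) (r : ℕ) :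
    minorIdeal (M * Q) r ≤ minorIdeal M r := by
  calc minorIdeal (M * Q) r = minorIdeal (Q.transpose * M.transpose).transpose r := by
        rw [← Matrix.transpose_mul, Matrix.transpose_transpose]
    _ ≤ minorIdeal (Q.transpose * M.transpose) r := minorIdeal_transpose_le _ _
    _ ≤ minorIdeal M.transpose r := minorIdeal_mul_le _ _ _
    _ ≤ minorIdeal M r := minorIdeal_transpose_le _ _

theorem minorIdeal_eq_of_mul_eq_mul [Fintype m] [Fintype n] [DecidableEq m] [DecidableEq n] {M D : Matrix m n R}
    {P : Matrix m m R} {Q : Matrix n n R}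
    (hP : IsUnit P.det) (hQ : IsUnit Q.det) (h : M * Q = P * D) (r : ℕ) :
    minorIdeal M r = minorIdeal D r := by
  refine le_antisymm ?_ ?_
  · have : M = P * (D * Q⁻¹) := by
      rw [← Matrix.mul_assoc, ← h, Matrix.mul_assoc, Matrix.mul_nonsing_inv _ hQ, Matrix.mul_one]
    rw [this]
    exact (minorIdeal_mul_le _ _ _).trans (minorIdeal_mul_le_left _ _ _)
  · have : D = P⁻¹ * (M * Q) := by
      rw [h, ← Matrix.mul_assoc, Matrix.nonsing_inv_mul _ hP, Matrix.one_mul]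
    rw [this]
    exact (minorIdeal_mul_le _ _ _).trans (minorIdeal_mul_le_left _ _ _)

/-- A minor of a diagonal matrix has a zero row unless the same indices are chosen for rows and
columns; then it is, up to sign, the product of the chosen entries. -/
theorem minorIdeal_diagonal [DecidableEq m] (d : m → R) (r : ℕ) :
    minorIdeal (Matrix.diagonal d) r =
      Ideal.span {q | ∃ s : Finset m, s.card = r ∧ q = ∏ x ∈ s, d x} := by
  refine le_antisymm (Ideal.span_le.2 ?_) (Ideal.span_le.2 ?_)
  · rintro _ ⟨f, g, rfl⟩
    by_cases hfg : ∀ s, ∃ t, g t = f s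
    · choose σ hσ using hfg
      have hσi : Function.Injective σ := fun s t hst => f.injective (by rw [← hσ, hst, hσ])
      let τ : Equiv.Perm (Fin r) := Equiv.ofBijective σ (Finite.injective_iff_bijective.1 hσi)
      have h : (Matrix.diagonal d).submatrix f g =
          (Matrix.diagonal (d ∘ g)).submatrix τ id := by
        ext s t
        simp [Matrix.diagonal_apply, τ, ← hσ]
      rw [h, Matrix.det_permute, Matrix.det_diagonal]
      refine Ideal.mul_mem_left _ _ (Ideal.subset_span ⟨Finset.univ.map g, by simp, by simp⟩)
    · push Not at hfg
      obtain ⟨s, hs⟩ := hfg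
      rw [Matrix.det_eq_zero_of_row_eq_zero s fun t => ?_]
      · exact Ideal.zero_mem _
      · simp [(hs t).symm]
  · rintro _ ⟨s, hs, rfl⟩
    let e := s.equivFinOfCardEq hs
    let f : Fin r ↪ m := e.symm.toEmbedding.trans (Function.Embedding.subtype _)
    refine Ideal.subset_span ⟨f, f, ?_⟩
    rw [Matrix.submatrix_diagonal _ _ f.injective, Matrix.det_diagonal, ← Finset.prod_coe_sort,
      ← Equiv.prod_comp e.symm]
    rfl

end MinorIdeals

/-! ### Smith form of the characteristic matrix of a Jordan matrix. -/

section CharacteristicMatrix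

open Polynomial

theorem RectSimilar.minorIdeal_charmatrix_le {m m' : Type*} [Fintype m] [Fintype m']
    [DecidableEq m] [DecidableEq m'] {A : Matrix m m ℂ} {J : Matrix m' m' ℂ}
    (h : RectSimilar A J) (r : ℕ) :
    minorIdeal A.charmatrix r ≤ minorIdeal J.charmatrix r := by
  obtain ⟨U, V, h1, h2, h3⟩ := h
  have e : A.charmatrix = U.map C * (J.charmatrix * V.map C) := by
    rw [Matrix.charmatrix, Matrix.charmatrix, Matrix.sub_mul, Matrix.mul_sub]
    congr 1
    · simp only [Matrix.scalar_apply, ← Matrix.smul_one_eq_diagonal, Matrix.mul_smul,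
        Matrix.one_mul, Matrix.smul_mul, ← Matrix.map_mul, h1]
      simp
    · rw [RingHom.mapMatrix_apply, RingHom.mapMatrix_apply, ← Matrix.map_mul, ← Matrix.map_mul,
        ← Matrix.mul_assoc, ← h3, Matrix.mul_assoc, h1, Matrix.mul_one]
  rw [e]
  exact (minorIdeal_mul_le _ _ _).trans (minorIdeal_mul_le_left _ _ _)

theorem charmatrix_jordanBlock_apply (r : ℕ) (z : ℂ) (s t : Fin r) :
    (jordanBlock r z).charmatrix s t =
      if s = t then X - C z else if (s : ℕ) + 1 = t then -1 else 0 := by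
  rw [Matrix.charmatrix_apply, Matrix.diagonal_apply, jordanBlock, Matrix.of_apply]
  split_ifs <;> simp

/-- The elementary divisors along the diagonal of a Jordan block. -/
def jordanDivisor (r : ℕ) (z : ℂ) (s : Fin r) : ℂ[X] :=
  if (s : ℕ) + 1 = r then (X - C z) ^ r else 1

theorem exists_smith_jordanBlock (r : ℕ) (z : ℂ) :
    ∃ P Q : Matrix (Fin r) (Fin r) ℂ[X], IsUnit P.det ∧ IsUnit Q.det ∧
      (jordanBlock r z).charmatrix * Q = P * Matrix.diagonal (jordanDivisor r z) := by
  set y : ℂ[X] := X - C z with hy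
  -- The last column `(1, y, …, y^(r-1))` is annihilated by every row of the characteristic matrix
  -- except the last, where it gives `y^r`. The other columns are sent to unit vectors up to an
  -- entry in the last row, which `P` records.
  let q : ℕ → ℕ → ℂ[X] := fun s t =>
    if t + 1 = r then y ^ s else if t + 1 ≤ s then -y ^ (s - t - 1) else 0
  let P : Matrix (Fin r) (Fin r) ℂ[X] := Matrix.of fun s t =>
    if s = t then 1 else if (s : ℕ) + 1 = r then -y ^ (r - 1 - t) else 0
  let Q : Matrix (Fin r) (Fin r) ℂ[X] := Matrix.of fun s t => q s t
  have hP : P.det = 1 := by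
    rw [Matrix.det_of_isLowerTriangular]
    · simp [P]
    · intro s t hst
      have hst' : (s : ℕ) < t := hst
      have h1 : s ≠ t := fun h => by omega
      have h2 : ¬ (s : ℕ) + 1 = r := by omega
      simp [P, h1, h2]
  have hM : (jordanBlock r z).charmatrix.det = y ^ r := by
    rw [Matrix.det_of_isUpperTriangular]
    · simp [jordanBlock, hy]
    · intro s t hst
      have hst' : (t : ℕ) < s := hst
      have h1 : s ≠ t := fun h => by omega
      have h2 : ¬ (s : ℕ) + 1 = t := by omega
      simp [jordanBlock, h1, h2]
  have hmul : (jordanBlock r z).charmatrix * Q = P * Matrix.diagonal (jordanDivisor r z) := by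
    ext1 s t
    have h1 : ((jordanBlock r z).charmatrix * Q) s t =
        y * q s t - if (s : ℕ) + 1 < r then q (s + 1) t else 0 := by
      have h2 : ∀ u : Fin r, (jordanBlock r z).charmatrix s u * Q u t =
          (if s = u then y * q u t else 0) +
            (if (s : ℕ) + 1 = (u : ℕ) then -q u t else 0) := by
        intro u
        rw [charmatrix_jordanBlock_apply]
        by_cases h : s = u
        · subst h; simp [Q, hy]
        · by_cases h' : (s : ℕ) + 1 = (u : ℕ) <;> simp [h, h', Q]
      rw [Matrix.mul_apply, Finset.sum_congr rfl fun u _ => h2 u, Finset.sum_add_distrib,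
        Finset.sum_ite_eq Finset.univ s, if_pos (Finset.mem_univ _), sub_eq_add_neg]
      congr 1
      split_ifs with h
      · have h3 : ∀ u : Fin r, ((s : ℕ) + 1 = (u : ℕ)) ↔ (⟨s + 1, h⟩ : Fin r) = u := fun u => by
          rw [Fin.ext_iff]
        simp_rw [h3]
        rw [Finset.sum_ite_eq Finset.univ, if_pos (Finset.mem_univ _)]
      · rw [neg_zero]
        exact Finset.sum_eq_zero fun u _ => if_neg (by omega)
    rw [h1, Matrix.mul_diagonal]
    have hs := s.2
    have ht := t.2
    simp only [P, q, Matrix.of_apply, jordanDivisor, ← hy, Fin.ext_iff]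
    by_cases htr : (t : ℕ) + 1 = r
    · simp only [htr, if_true]
      by_cases hsr : (s : ℕ) + 1 = r
      · rw [if_neg (by omega), if_pos (by omega), sub_zero, one_mul, ← pow_succ', hsr]
      · rw [if_pos (by omega), if_neg (by omega), if_neg hsr, zero_mul, ← pow_succ', sub_self]
    · simp only [htr, if_false, mul_one]
      by_cases hsr : (s : ℕ) + 1 = r
      · rw [if_pos (by omega), if_neg (by omega), if_neg (by omega), if_pos hsr, sub_zero,
          mul_neg, ← pow_succ']
        congr 2
        omega
      · rw [if_pos (show (s : ℕ) + 1 < r by omega), if_neg hsr]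
        rcases lt_trichotomy (s : ℕ) t with hlt | heq | hgt
        · rw [if_neg (by omega), if_neg (by omega), if_neg (by omega)]
          simp
        · rw [if_neg (by omega), if_pos (by omega), if_pos heq, heq]
          simp
        · rw [if_pos (by omega), if_pos (by omega), if_neg (by omega), mul_neg, ← pow_succ']
          rw [show (s : ℕ) - t - 1 + 1 = s + 1 - t - 1 by omega, sub_self]
  refine ⟨P, Q, by rw [hP]; exact isUnit_one, ?_, hmul⟩
  -- The determinant of `Q` follows by cancellation: the characteristic matrix and the diagonal
  -- matrix both have determinant `y^r`, and `det P = 1`.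
  have hdet := congrArg Matrix.det hmul
  rw [Matrix.det_mul, Matrix.det_mul, hM, hP, one_mul, Matrix.det_diagonal] at hdet
  have hprod : ∏ s, jordanDivisor r z s = y ^ r := by
    rcases Nat.eq_zero_or_pos r with h0 | hpos
    · subst h0; simp
    · rw [Finset.prod_eq_single (⟨r - 1, by omega⟩ : Fin r)]
      · simp [jordanDivisor, Nat.sub_add_cancel hpos, hy]
      · intro s _ hs
        refine if_neg fun h => hs (Fin.ext ?_)
        simp only
        omega
      · simp
  rw [hprod] at hdet
  have : Q.det = 1 := mul_left_cancel₀ (pow_ne_zero r (X_sub_C_ne_zero z)) (by rw [mul_one, hdet])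
  rw [this]
  exact isUnit_one

variable {p : ℕ} {N : Fin p → ℕ} {k : Fin p → ℕ → ℕ}

theorem minorIdeal_charmatrix_jordanMatrix (ev : Fin p → ℂ) (r : ℕ) :
    minorIdeal (jordanMatrix N k ev).charmatrix r =
      minorIdeal (Matrix.diagonal fun x : JordanIndex N k =>
        jordanDivisor (k x.1.1 ((x.1.2 : ℕ) + 1)) (ev x.1.1) x.2) r := by
  choose P Q hP hQ hPQ using fun b : (Σ a : Fin p, Fin (N a)) =>
    exists_smith_jordanBlock (k b.1 ((b.2 : ℕ) + 1)) (ev b.1)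
  have e : (jordanMatrix N k ev).charmatrix =
      Matrix.blockDiagonal' fun b : (Σ a : Fin p, Fin (N a)) =>
      (jordanBlock (k b.1 ((b.2 : ℕ) + 1)) (ev b.1)).charmatrix := by
    ext1 ⟨b, s⟩ ⟨c, t⟩
    rw [Matrix.charmatrix_apply, jordanMatrix, Matrix.diagonal_apply]
    by_cases hbc : b = c
    · subst hbc
      rw [Matrix.blockDiagonal'_apply_eq, Matrix.blockDiagonal'_apply_eq, Matrix.charmatrix_apply,
        Matrix.diagonal_apply]
      simp
    · rw [Matrix.blockDiagonal'_apply_ne _ _ _ hbc, Matrix.blockDiagonal'_apply_ne _ _ _ hbc]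
      simp [hbc]
  refine minorIdeal_eq_of_mul_eq_mul (P := Matrix.blockDiagonal' P) (Q := Matrix.blockDiagonal' Q)
    ?_ ?_ ?_ r
  · rw [det_blockDiagonal_sigma]
    exact IsUnit.prod_univ_iff.2 hP
  · rw [det_blockDiagonal_sigma]
    exact IsUnit.prod_univ_iff.2 hQ
  · rw [e, ← Matrix.blockDiagonal'_mul]
    simp_rw [hPQ]
    rw [Matrix.blockDiagonal'_mul, Matrix.blockDiagonal'_diagonal]

/-- The greatest common divisor is handled through its divisors, so its generator and normalization
never need to be computed. -/
theorem dvd_determinantalDivisor_iff {n : ℕ} {A : Matrix (Fin n) (Fin n) ℂ} {ev : Fin p → ℂ}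
    (h : RectSimilar A (jordanMatrix N k ev)) (r : ℕ) (q : ℂ[X]) :
    q ∣ determinantalDivisor A r ↔ ∀ s : Finset (JordanIndex N k), s.card = r →
      q ∣ ∏ x ∈ s, jordanDivisor (k x.1.1 ((x.1.2 : ℕ) + 1)) (ev x.1.1) x.2 := by
  have hI : minorIdeal A.charmatrix r = _ :=
    (le_antisymm (h.minorIdeal_charmatrix_le r) (h.symm.minorIdeal_charmatrix_le r)).trans
      ((minorIdeal_charmatrix_jordanMatrix ev r).trans (minorIdeal_diagonal _ r))
  rw [determinantalDivisor, dvd_normalize_iff]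
  change q ∣ Submodule.IsPrincipal.generator (minorIdeal A.charmatrix r) ↔ _
  rw [← Ideal.mem_span_singleton, ← Ideal.span_singleton_le_iff_mem,
    Ideal.span_singleton_generator, hI, Ideal.span_le]
  constructor
  · intro H s hs
    exact Ideal.mem_span_singleton.1 (H ⟨s, hs, rfl⟩)
  · rintro H _ ⟨s, hs, rfl⟩
    exact Ideal.mem_span_singleton.2 (H s hs)

end CharacteristicMatrix
-- Degrees of polynomials with prescribed roots.
section FactoredPolynomials

open Polynomial

variable {p : ℕ}

/-- The monic polynomial with roots `ev a` of multiplicity `w a`. -/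
def rootsProd (ev : Fin p → ℂ) (w : Fin p → ℕ) : ℂ[X] := ∏ a, (X - C (ev a)) ^ w a

theorem rootsProd_ne_zero (ev : Fin p → ℂ) (w : Fin p → ℕ) : rootsProd ev w ≠ 0 :=
  Finset.prod_ne_zero_iff.2 fun _ _ => pow_ne_zero _ (X_sub_C_ne_zero _)

theorem rootsProd_dvd (ev : Fin p → ℂ) {w w' : Fin p → ℕ} (h : ∀ a, w a ≤ w' a) :
    rootsProd ev w ∣ rootsProd ev w' :=
  Finset.prod_dvd_prod_of_dvd _ _ fun a _ => pow_dvd_pow _ (h a)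

theorem natDegree_rootsProd (ev : Fin p → ℂ) (w : Fin p → ℕ) :
    (rootsProd ev w).natDegree = ∑ a, w a := by
  rw [rootsProd, natDegree_prod_of_monic _ _ fun a _ => (monic_X_sub_C _).pow _]
  simp

theorem rootMultiplicity_rootsProd (ev : Fin p → ℂ) (w : Fin p → ℕ) (z : ℂ) :
    (rootsProd ev w).rootMultiplicity z = ∑ a, if z = ev a then w a else 0 := by
  rw [← count_roots, rootsProd, roots_prod _ _ (rootsProd_ne_zero ev w), Multiset.count_bind]
  simp only [roots_pow, roots_X_sub_C, Multiset.count_nsmul, Multiset.count_singleton]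
  simp [Finset.sum]

/-- The bound from above is checked one root at a time: `h3` may use a different multiple of `D` for
each eigenvalue, and `h2` excludes other roots and `D = 0`. -/
theorem natDegree_eq_of_rootMultiplicity {ev : Fin p → ℂ} (hev : Function.Injective ev)
    {D : ℂ[X]} {w : Fin p → ℕ} (h1 : rootsProd ev w ∣ D)
    (h2 : ∃ w', D ∣ rootsProd ev w')
    (h3 : ∀ a, ∃ w', D ∣ rootsProd ev w' ∧ w' a ≤ w a) : D.natDegree = ∑ a, w a := by
  obtain ⟨w₀, hw₀⟩ := h2
  have hD : D ≠ 0 := fun h => rootsProd_ne_zero ev w₀ (zero_dvd_iff.1 (h ▸ hw₀))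
  refine le_antisymm ?_ (by rw [← natDegree_rootsProd ev w]; exact natDegree_le_of_dvd h1 hD)
  have hle : D.roots ≤ (rootsProd ev w).roots := by
    rw [Multiset.le_iff_count]
    intro z
    rw [count_roots, count_roots, rootMultiplicity_rootsProd]
    by_cases hz : ∃ a, z = ev a
    · obtain ⟨a, rfl⟩ := hz
      obtain ⟨w', hw', hle⟩ := h3 a
      refine (rootMultiplicity_le_rootMultiplicity_of_dvd (rootsProd_ne_zero ev w') hw' _).trans ?_
      rw [rootMultiplicity_rootsProd]
      simpa [hev.eq_iff] using hle
    · push Not at hz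
      refine (rootMultiplicity_le_rootMultiplicity_of_dvd (rootsProd_ne_zero ev w₀) hw₀ _).trans ?_
      rw [rootMultiplicity_rootsProd]
      simp [hz]
  have := Multiset.card_le_card hle
  rwa [← (IsAlgClosed.splits D).natDegree_eq_card_roots,
    ← (IsAlgClosed.splits (rootsProd ev w)).natDegree_eq_card_roots,
    natDegree_rootsProd] at this

/-- The Euclidean quotient already has this degree, so divisibility of consecutive determinantal
divisors is not required. -/
theorem natDegree_div_eq_sub {P Q : ℂ[X]} (hP : P ≠ 0) (hQ : Q ≠ 0)
    (h : Q.natDegree ≤ P.natDegree) : (P / Q).natDegree = P.natDegree - Q.natDegree := by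
  have h1 := degree_add_div hQ (show Q.degree ≤ P.degree by
    rw [degree_eq_natDegree hP, degree_eq_natDegree hQ]; exact_mod_cast h)
  have h2 : P / Q ≠ 0 := by
    intro h0
    rw [h0, degree_zero, WithBot.add_bot] at h1
    exact hP (degree_eq_bot.1 h1.symm)
  rw [degree_eq_natDegree hP, degree_eq_natDegree hQ, degree_eq_natDegree h2] at h1
  have h3 : Q.natDegree + (P / Q).natDegree = P.natDegree := by exact_mod_cast h1
  omega

end FactoredPolynomials

/-! ### Sums of decreasing sequences. -/

section Sums

theorem Antitone.sum_le_sum_range {u : ℕ → ℕ} (hu : Antitone u) {c : Finset ℕ} {j : ℕ}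
    (hc : c.card ≤ j) : ∑ i ∈ c, u i ≤ ∑ i ∈ Finset.range j, u i := by
  have h1 := Finset.sum_inter_add_sum_sdiff c (Finset.range j) u
  have h2 := Finset.sum_inter_add_sum_sdiff (Finset.range j) c u
  rw [Finset.inter_comm] at h2
  have h3 : ∑ i ∈ c \ Finset.range j, u i ≤ (c \ Finset.range j).card • u j :=
    Finset.sum_le_card_nsmul _ _ _ fun i hi => hu (by simpa using (Finset.mem_sdiff.1 hi).2)
  have h4 : (Finset.range j \ c).card • u j ≤ ∑ i ∈ Finset.range j \ c, u i :=
    Finset.card_nsmul_le_sum _ _ _ fun i hi =>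
      hu (Finset.mem_range.1 (Finset.mem_sdiff.1 hi).1).le
  have h5 : (c \ Finset.range j).card ≤ (Finset.range j \ c).card :=
    Finset.card_sdiff_le_card_sdiff_iff.2 (by simpa using hc)
  have h6 := Nat.mul_le_mul_right (u j) h5
  simp only [smul_eq_mul] at h3 h4
  omega

/-- Exactly `2 m + 1` pairs have larger index `m`, and for each of them the minimum is `u m`.
Counting from zero, this is the weight `2 j - 1` with `j = m + 1`. -/
theorem Antitone.sum_sum_min {u : ℕ → ℕ} (hu : Antitone u) (M : ℕ) :
    ∑ i ∈ Finset.range M, ∑ j ∈ Finset.range M, min (u i) (u j) =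
      ∑ i ∈ Finset.range M, (2 * i + 1) * u i := by
  induction M with
  | zero => simp
  | succ M ih =>
    have h1 : ∀ i ∈ Finset.range M, min (u i) (u M) = u M := fun i hi =>
      min_eq_right (hu (Finset.mem_range.1 hi).le)
    have h2 : ∀ i ∈ Finset.range M, min (u M) (u i) = u M := fun i hi =>
      min_eq_left (hu (Finset.mem_range.1 hi).le)
    simp only [Finset.sum_range_succ, Finset.sum_add_distrib, ih]
    rw [Finset.sum_congr rfl h1, Finset.sum_congr rfl h2]
    simp
    ring

end Sums

/-! ### Degrees of determinantal divisors and invariant polynomials. -/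

section InvariantPolynomials

open Polynomial

variable {n p : ℕ} {N : Fin p → ℕ} {k : Fin p → ℕ → ℕ}

theorem sum_blockOrder_Icc (a : Fin p) (M : ℕ) :
    ∑ j ∈ Finset.Icc 1 M, k a j = ∑ i ∈ Finset.range M, k a (i + 1) := by
  rw [Finset.range_eq_Ico, Finset.sum_Ico_add' (fun j => k a j) 0 M 1]
  rfl

theorem centralizerDim_eq (hanti : ∀ a, AntitoneOn (k a) (Set.Icc 1 (N a)))
    (hzero : ∀ a j, N a < j → k a j = 0) :
    (centralizerDim N k : ℤ) =
      ∑ j ∈ Finset.Icc 1 (Finset.univ.sup N), (2 * (j : ℤ) - 1) * ∑ a, (k a j : ℤ) := by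
  have h1 : centralizerDim N k =
      ∑ a, ∑ i ∈ Finset.range (Finset.univ.sup N), (2 * i + 1) * k a (i + 1) := by
    rw [centralizerDim, Fintype.sum_sigma]
    refine Finset.sum_congr rfl fun a _ => ?_
    have h2 : ∀ i : Fin (N a), (∑ c : (Σ a : Fin p, Fin (N a)),
        if a = c.1 then min (k a ((i : ℕ) + 1)) (k c.1 ((c.2 : ℕ) + 1)) else 0) =
        ∑ j ∈ Finset.range (N a), min (k a ((i : ℕ) + 1)) (k a (j + 1)) := by
      intro i
      rw [Fintype.sum_sigma, Finset.sum_eq_single a]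
      · simp [Finset.sum_range]
      · intro b _ hb
        simp [Ne.symm hb]
      · simp
    rw [Finset.sum_congr rfl fun i _ => h2 i,
      ← Finset.sum_range (fun i => ∑ j ∈ Finset.range (N a), min (k a (i + 1)) (k a (j + 1))),
      (antitone_shift hanti hzero a).sum_sum_min]
    refine Finset.sum_subset (Finset.range_subset_range.2 (Finset.le_sup (Finset.mem_univ a)))
      fun j _ hj => ?_
    rw [hzero a (j + 1) (by simpa [Nat.lt_succ_iff] using hj), mul_zero]
  rw [h1, Finset.sum_comm]
  push_cast
  rw [Finset.range_eq_Ico, Finset.sum_congr rfl fun i _ => (Finset.mul_sum _ _ _).symm]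
  rw [← Finset.sum_Ico_add' (fun j : ℕ => (2 * (j : ℤ) - 1) * ∑ a, (k a j : ℤ)) 0 _ 1 |>.trans
    (by rfl : _ = ∑ j ∈ Finset.Icc 1 (Finset.univ.sup N), (2 * (j : ℤ) - 1) * ∑ a, (k a j : ℤ))]
  refine Finset.sum_congr rfl fun i _ => ?_
  push_cast
  ring

/-- The exponent of the `a`-th eigenvalue in a product of elementary divisors. -/
def divisorExponent (s : Finset (JordanIndex N k)) (a : Fin p) : ℕ :=
  ∑ x ∈ s, if x.1.1 = a ∧ (x.2 : ℕ) + 1 = k x.1.1 ((x.1.2 : ℕ) + 1) then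
    k x.1.1 ((x.1.2 : ℕ) + 1) else 0

theorem prod_jordanDivisor (ev : Fin p → ℂ) (s : Finset (JordanIndex N k)) :
    ∏ x ∈ s, jordanDivisor (k x.1.1 ((x.1.2 : ℕ) + 1)) (ev x.1.1) x.2 =
      rootsProd ev (divisorExponent s) := by
  rw [rootsProd]
  simp only [divisorExponent, ← Finset.prod_pow_eq_pow_sum]
  rw [Finset.prod_comm]
  refine Finset.prod_congr rfl fun x _ => ?_
  rw [Finset.prod_eq_single x.1.1]
  · rw [jordanDivisor]
    split_ifs <;> simp_all
  · intro b _ hb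
    simp [Ne.symm hb]
  · simp

theorem blockOrder_pos (hpos : ∀ a, ∀ j ∈ Finset.Icc 1 (N a), 1 ≤ k a j) (a : Fin p)
    (i : Fin (N a)) : 1 ≤ k a ((i : ℕ) + 1) :=
  hpos a _ (Finset.mem_Icc.2 ⟨by omega, i.2⟩)

/-- The last position of a Jordan block. -/
def lastIndex (hpos : ∀ a, ∀ j ∈ Finset.Icc 1 (N a), 1 ≤ k a j) (a : Fin p) (i : Fin (N a)) :
    JordanIndex N k :=
  ⟨⟨a, i⟩, ⟨k a ((i : ℕ) + 1) - 1, Nat.sub_lt (blockOrder_pos hpos a i) one_pos⟩⟩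

theorem lastIndex_injective (hpos : ∀ a, ∀ j ∈ Finset.Icc 1 (N a), 1 ≤ k a j) (a : Fin p) :
    Function.Injective (lastIndex hpos a) := by
  intro i j h
  have := (jordanIndex_ext_iff.1 h).1
  exact Fin.ext (blockIndex_ext_iff.1 this).2

/-- Only the last position of a block carries a nontrivial elementary divisor. -/
theorem divisorExponent_eq (hpos : ∀ a, ∀ j ∈ Finset.Icc 1 (N a), 1 ≤ k a j)
    (s : Finset (JordanIndex N k)) (a : Fin p) :
    divisorExponent s a =
      ∑ i : Fin (N a), if lastIndex hpos a i ∈ s then k a ((i : ℕ) + 1) else 0 := by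
  rw [divisorExponent, ← Finset.sum_filter, ← Finset.sum_filter]
  symm
  refine Finset.sum_bij (fun i _ => lastIndex hpos a i) (fun i hi => ?_)
    (fun i _ j _ h => lastIndex_injective hpos a h) (fun x hx => ?_) (fun i _ => rfl)
  · rw [Finset.mem_filter] at hi ⊢
    exact ⟨hi.2, rfl, Nat.sub_add_cancel (blockOrder_pos hpos a i)⟩
  · obtain ⟨hxs, hxa, hxt⟩ := Finset.mem_filter.1 hx
    obtain ⟨⟨b, i⟩, t⟩ := x
    simp only at hxa hxt
    subst hxa
    have hlast : lastIndex hpos b i = ⟨⟨b, i⟩, t⟩ :=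
      jordanIndex_ext_iff.2 ⟨rfl, by simp only [lastIndex]; omega⟩
    exact ⟨i, Finset.mem_filter.2 ⟨Finset.mem_univ i, hlast ▸ hxs⟩, hlast⟩

theorem card_jordanIndex (N : Fin p → ℕ) (k : Fin p → ℕ → ℕ) :
    Fintype.card (JordanIndex N k) = ∑ a, ∑ j ∈ Finset.Icc 1 (N a), k a j := by
  rw [Fintype.card_sigma, Fintype.sum_sigma]
  refine Finset.sum_congr rfl fun a _ => ?_
  rw [sum_blockOrder_Icc, Finset.sum_range]
  simp

/-- The degree of the determinantal divisors of a matrix of given Jordan type. -/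
theorem natDegree_determinantalDivisor
    (hpos : ∀ a, ∀ j ∈ Finset.Icc 1 (N a), 1 ≤ k a j)
    (hanti : ∀ a, AntitoneOn (k a) (Set.Icc 1 (N a)))
    (hzero : ∀ a j, N a < j → k a j = 0) {A : Matrix (Fin n) (Fin n) ℂ} {ev : Fin p → ℂ}
    (hcard : Fintype.card (JordanIndex N k) = n)
    (hev : Function.Injective ev) (h : RectSimilar A (jordanMatrix N k ev)) {j : ℕ} (hj : j ≤ n) :
    determinantalDivisor A (n - j) ≠ 0 ∧ (determinantalDivisor A (n - j)).natDegree =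
      ∑ a, ∑ i ∈ Finset.range (N a), if i < j then 0 else k a (i + 1) := by
  classical
  have hdvd := dvd_determinantalDivisor_iff h (n - j)
  simp only [prod_jordanDivisor] at hdvd
  have hcompl : ∀ t : Finset (JordanIndex N k), t.card = j → tᶜ.card = n - j := fun t ht => by
    rw [Finset.card_compl, hcard, ht]
  obtain ⟨t₀, -, ht₀⟩ := Finset.exists_subset_card_eq
    (s := (Finset.univ : Finset (JordanIndex N k))) (n := j) (by rwa [Finset.card_univ, hcard])
  have hself := (hdvd _).1 dvd_rfl
  refine ⟨fun h0 => ?_, natDegree_eq_of_rootMultiplicity hev ((hdvd _).2 fun s hs =>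
    rootsProd_dvd ev fun a => ?_) ⟨_, hself _ (hcompl t₀ ht₀)⟩ fun a => ?_⟩
  · have := hself _ (hcompl t₀ ht₀)
    rw [h0, zero_dvd_iff] at this
    exact rootsProd_ne_zero _ _ this
  · rw [divisorExponent_eq hpos, Finset.sum_range]
    have e1 : ∀ i : Fin (N a), (if lastIndex hpos a i ∈ s then k a ((i : ℕ) + 1) else 0) +
        (if lastIndex hpos a i ∈ sᶜ then k a ((i : ℕ) + 1) else 0) = k a ((i : ℕ) + 1) := by
      intro i
      by_cases hi : lastIndex hpos a i ∈ s <;> simp [hi]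
    have e2 : ∀ i : Fin (N a), (if (i : ℕ) < j then 0 else k a ((i : ℕ) + 1)) +
        (if (i : ℕ) < j then k a ((i : ℕ) + 1) else 0) = k a ((i : ℕ) + 1) := by
      intro i
      split_ifs <;> simp
    have e3 := Finset.sum_congr rfl fun i (_ : i ∈ Finset.univ) => (e1 i).trans (e2 i).symm
    rw [Finset.sum_add_distrib, Finset.sum_add_distrib] at e3
    have hsc : sᶜ.card = j := by
      rw [Finset.card_compl, hcard, hs]
      omega
    -- Choosing `n - j` positions omits `j` of them, and the omitted blocks of one eigenvalue weigh
    -- at most as much as its `j` largest blocks.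
    have e4 : ∑ i : Fin (N a), (if lastIndex hpos a i ∈ sᶜ then k a ((i : ℕ) + 1) else 0) ≤
        ∑ i : Fin (N a), if (i : ℕ) < j then k a ((i : ℕ) + 1) else 0 := by
      have f1 : ∑ i : Fin (N a), (if lastIndex hpos a i ∈ sᶜ then k a ((i : ℕ) + 1) else 0) =
          ∑ i ∈ (Finset.univ.filter fun i => lastIndex hpos a i ∈ sᶜ).map Fin.valEmbedding,
            k a (i + 1) := by
        rw [← Finset.sum_filter, Finset.sum_map]
        rfl
      have f2 : ∑ i : Fin (N a), (if (i : ℕ) < j then k a ((i : ℕ) + 1) else 0) =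
          ∑ i ∈ Finset.range j, k a (i + 1) := by
        rw [← Finset.sum_range (fun i => if i < j then k a (i + 1) else 0), ← Finset.sum_filter]
        refine Finset.sum_subset (fun i hi => ?_) fun i hi hi' => ?_
        · exact Finset.mem_range.2 (Finset.mem_filter.1 hi).2
        · refine hzero a _ ?_
          by_contra hlt
          exact hi' (Finset.mem_filter.2 ⟨Finset.mem_range.2 (by omega), Finset.mem_range.1 hi⟩)
      rw [f1, f2]
      refine (antitone_shift hanti hzero a).sum_le_sum_range ?_
      rw [Finset.card_map, ← hsc]
      exact Finset.card_le_card_of_injOn (lastIndex hpos a) (fun i hi => by simpa using hi)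
        (lastIndex_injective hpos a).injOn
    omega
  -- Equality for the eigenvalue `a` is reached by omitting the last positions of its first `j`
  -- blocks, or of all of them if there are fewer, filled up arbitrarily to `j` positions.
  · let c : Finset (JordanIndex N k) :=
      (Finset.univ.filter fun i : Fin (N a) => (i : ℕ) < j).map ⟨_, lastIndex_injective hpos a⟩
    have hc : c.card ≤ j := by
      rw [Finset.card_map]
      calc (Finset.univ.filter fun i : Fin (N a) => (i : ℕ) < j).card
          ≤ (Finset.range j).card :=
            Finset.card_le_card_of_injOn (fun i => (i : ℕ)) (fun i hi => by simpa using hi)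
              Fin.val_injective.injOn
        _ = j := Finset.card_range j
    obtain ⟨t, hct, -, ht⟩ := Finset.exists_subsuperset_card_eq (Finset.subset_univ c) hc
      (by rwa [Finset.card_univ, hcard])
    refine ⟨_, hself _ (hcompl t ht), ?_⟩
    rw [divisorExponent_eq hpos, Finset.sum_range]
    refine Finset.sum_le_sum fun i _ => ?_
    by_cases hi : (i : ℕ) < j
    · have hmem : lastIndex hpos a i ∈ t :=
        hct (Finset.mem_map.2 ⟨i, by simpa using hi, rfl⟩)
      simp [hmem]
    · rw [if_neg hi]
      split_ifs <;> simp

/-- The degree of the invariant polynomials of a matrix of given Jordan type. -/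
theorem natDegree_invariantPolynomial
    (hpos : ∀ a, ∀ j ∈ Finset.Icc 1 (N a), 1 ≤ k a j)
    (hanti : ∀ a, AntitoneOn (k a) (Set.Icc 1 (N a)))
    (hzero : ∀ a j, N a < j → k a j = 0) {A : Matrix (Fin n) (Fin n) ℂ}
    (hcard : Fintype.card (JordanIndex N k) = n) (hA : A ∈ jordanSet n N k)
    {j : ℕ} (hj1 : 1 ≤ j) (hj : j ≤ n) :
    (invariantPolynomial A j).natDegree = ∑ a, k a j := by
  obtain ⟨ev, hev, h⟩ := mem_jordanSet_iff.1 hA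
  obtain ⟨i, rfl⟩ := Nat.exists_eq_add_of_le' hj1
  obtain ⟨a1, a2⟩ := natDegree_determinantalDivisor hpos hanti hzero hcard hev h
    (show i ≤ n by omega)
  obtain ⟨b1, b2⟩ := natDegree_determinantalDivisor hpos hanti hzero hcard hev h hj
  -- The two degrees differ exactly by the summands `l = i`; if `i` is out of range, `k a (i + 1)`
  -- is zero.
  have key : ∑ a, ∑ l ∈ Finset.range (N a), (if l < i then 0 else k a (l + 1)) =
      (∑ a, ∑ l ∈ Finset.range (N a), if l < i + 1 then 0 else k a (l + 1)) + ∑ a, k a (i + 1) := by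
    rw [← Finset.sum_add_distrib]
    refine Finset.sum_congr rfl fun a _ => ?_
    have : k a (i + 1) = ∑ l ∈ Finset.range (N a), if l = i then k a (l + 1) else 0 := by
      rw [Finset.sum_ite_eq' _ i]
      split_ifs with hi
      · rfl
      · exact hzero a _ (by simpa [Nat.lt_succ_iff] using hi)
    rw [this, ← Finset.sum_add_distrib]
    refine Finset.sum_congr rfl fun l _ => ?_
    rcases lt_trichotomy l i with hl | hl | hl
    · simp [hl, hl.ne, hl.trans (Nat.lt_succ_self i)]
    · simp [hl]
    · rw [if_neg (by omega), if_neg (by omega), if_neg (by omega), add_zero]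
  rw [invariantPolynomial, show n + 1 - (i + 1) = n - i by omega,
    natDegree_div_eq_sub a1 b1 (by rw [a2, b2]; omega), a2, b2]
  omega

theorem jordanSet_nonempty (hcard : Fintype.card (JordanIndex N k) = n) :
    (jordanSet n N k).Nonempty := by
  have e : Fin n ≃ JordanIndex N k := Fintype.equivOfCardEq (by rw [hcard, Fintype.card_fin])
  refine ⟨_, fun a => ((a : ℕ) : ℂ), e, 1, fun a b h => ?_, rfl⟩
  exact Fin.ext (Nat.cast_injective h)

end InvariantPolynomials
end

theorem theorem7 (n p : ℕ) (mult : Fin p → ℕ) (N : Fin p → ℕ) (k : Fin p → ℕ → ℕ)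
    (hN : ∀ a, 1 ≤ N a)
    (hpos : ∀ a, ∀ j ∈ Finset.Icc 1 (N a), 1 ≤ k a j)
    (hanti : ∀ a, AntitoneOn (k a) (Set.Icc 1 (N a)))
    (hzero : ∀ a j, N a < j → k a j = 0)
    (hmult : ∀ a, ∑ j ∈ Finset.Icc 1 (N a), k a j = mult a)
    (hsum : ∑ a, mult a = n) :
    ∃ d : ℕ, HasComplexDim (jordanSet n N k) d ∧
      (d : ℤ) = (n : ℤ) ^ 2
        - ∑ j ∈ Finset.Icc 1 (Finset.univ.sup N), (2 * (j : ℤ) - 1) * ∑ a, (k a j : ℤ) + p ∧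
      ∀ A ∈ jordanSet n N k,
        (d : ℤ) = (n : ℤ) ^ 2
          - ∑ j ∈ Finset.Icc 1 (Finset.univ.sup N),
              (2 * (j : ℤ) - 1) * ((invariantPolynomial A j).natDegree : ℤ) + p := by
  have hcard : Fintype.card (JordanIndex N k) = n := by
    rw [card_jordanIndex, ← hsum]
    exact Finset.sum_congr rfl fun a _ => hmult a
  -- Blocks have order at least 1, so every index `j` in the sum is at most `n`, as the degree
  -- formula for invariant polynomials requires.
  have hsup : Finset.univ.sup N ≤ n := by
    refine Finset.sup_le fun a _ => ?_
    calc N a = ∑ j ∈ Finset.Icc 1 (N a), 1 := by simp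
      _ ≤ ∑ j ∈ Finset.Icc 1 (N a), k a j := Finset.sum_le_sum (hpos a)
      _ = mult a := hmult a
      _ ≤ ∑ a, mult a := Finset.single_le_sum (fun _ _ => Nat.zero_le _) (Finset.mem_univ a)
      _ = n := hsum
  obtain ⟨A₀, hA₀⟩ := jordanSet_nonempty hcard
  obtain ⟨-, W₀, -, -, -, hW₀, -⟩ := exists_straightening_jordanSet hN hpos hanti hzero hA₀
  have hdim : ((Module.finrank ℂ W₀ : ℕ) : ℤ) = (n : ℤ) ^ 2
      - ∑ j ∈ Finset.Icc 1 (Finset.univ.sup N), (2 * (j : ℤ) - 1) * ∑ a, (k a j : ℤ) + p := by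
    rw [← centralizerDim_eq hanti hzero]
    have : ((Module.finrank ℂ W₀ : ℕ) : ℤ) + centralizerDim N k = n ^ 2 + p := by
      exact_mod_cast hW₀
    linarith
  refine ⟨Module.finrank ℂ W₀, ⟨⟨A₀, hA₀⟩, fun A hA => ?_⟩, hdim, fun A hA => ?_⟩
  -- The dimension is the same at all points, because its sum with `centralizerDim N k` is always `n
  -- ^ 2 + p`.
  · obtain ⟨φ, W, h1, h2, h3, h4, h5⟩ := exists_straightening_jordanSet hN hpos hanti hzero hA
    exact ⟨φ, W, h1, h2, h3, by omega, h5⟩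
  · rw [hdim]
    congr 2
    refine Finset.sum_congr rfl fun j hj => ?_
    obtain ⟨hj1, hj2⟩ := Finset.mem_Icc.1 hj
    rw [natDegree_invariantPolynomial hpos hanti hzero hcard hA hj1 (hj2.trans hsup)]
    push_cast
    rfl
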